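/- Let $M, N_D$ be natural numbers and let $R_1,\dots,R_M$ be real symmetric $4\times 4$ matrices. Let $\mathcal A=\mathrm{clos}\{R_m\}\subseteq \mathrm{Mat}_4(\mathbb R)$ be their closure algebra, i.e. the (unital) real $C^*$-algebra of matrices generated by the $R_m$, acting on $\mathbb R^4$ by matrix–vector multiplication, and let $$\mathfrak h=\{X\in\mathfrak{so}(4N_D)\;:\;[\,1_{N_D\times N_D}\otimes R_m,\,X\,]=0\ \text{ for all } m\}$$ be the commutant Lie subalgebra of $\mathfrak{so}(4N_D)$. Call an irreducible $\mathcal A$-module $\rho$ real, complex or quaternionic if its endomorphism algebra $\mathrm{End}_{\mathcal A}(\rho)$ is isomorphic, as a real algebra, to $\mathbb R$, $\mathbb C$ or $\mathbb H$ respectively. Then: 1. Every irreducible $\mathcal A$-submodule of $\mathbb R^4$ is of exactly one of these three types, and $\mathbb R^4$ can be decomposed into irreducible modules as $$\mathbb R^4\;\cong\;\bigoplus_{j}(\rho^{\mathbb R}_j)^{\oplus m^{\mathbb R}_j}\ \oplus\ \bigoplus_{j}(\rho^{\mathbb C}_j)^{\oplus m^{\mathbb C}_j}\ \oplus\ \bigoplus_{j}(\rho^{\mathbb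 H}_j)^{\oplus m^{\mathbb H}_j},$$ where the sums are finite (possibly empty), the $\rho^{\mathbb R}_j$, $\rho^{\mathbb C}_j$, $\rho^{\mathbb H}_j$ are pairwise non-isomorphic irreducible $\mathcal A$-modules of real, complex and quaternionic type respectively, and all multiplicities are positive. 2. For every such decomposition there is an isomorphism of real Lie algebras $$\mathfrak h\;\cong\;\bigoplus_j \mathfrak{so}(m^{\mathbb R}_j N_D)\ \oplus\ \bigoplus_j \mathfrak{u}(m^{\mathbb C}_j N_D)\ \oplus\ \bigoplus_j \mathfrak{sp}(m^{\mathbb H}_j N_D).$$ Here $\mathfrak{so}(n)$, $\mathfrak u(n)$ and $\mathfrak{sp}(n)$ are the real Lie algebras of anti-Hermitian $n\times n$ matrices over $\mathbb R$, $\mathbb C$ and $\mathbb H$ respectively, with the commutator bracket. -/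

import Mathlib

open scoped Kronecker DirectSum Quaternion

-- The Lie bracket on an associative algebra is the commutator (an opt-in instance of Mathlib).
attribute [local instance 100] LieRing.ofAssociativeRing

namespace GNY

/-- `ℝ⁴`, the space of column vectors on which real `4 × 4` matrices act by matrix-vector
multiplication. -/
abbrev V : Type := Fin 4 → ℝ

instance : Module (Matrix (Fin 4) (Fin 4) ℝ) V := Matrix.Module.matrixModule

theorem matrix_smul (X : Matrix (Fin 4) (Fin 4) ℝ) (v : V) : X • v = X.mulVec v := rfl

instance : IsScalarTower ℝ (Matrix (Fin 4) (Fin 4) ℝ) V :=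
  ⟨fun c X v => by simp [matrix_smul, Matrix.smul_mulVec]⟩

/-- The closure algebra of `{R_m}`: the (unital) real star algebra of `4 × 4` matrices generated by
the `R_m`. It is finite-dimensional, hence closed, so it is the real C⋆-algebra they generate. -/
noncomputable def clos {M : ℕ} (R : Fin M → Matrix (Fin 4) (Fin 4) ℝ) :
    Subalgebra ℝ (Matrix (Fin 4) (Fin 4) ℝ) :=
  (StarAlgebra.adjoin ℝ (Set.range R)).toSubalgebra

/-- `R̂ = 1_{N × N} ⊗ R`. -/
def hat (N : ℕ) (R : Matrix (Fin 4) (Fin 4) ℝ) : Matrix (Fin N × Fin 4) (Fin N × Fin 4) ℝ :=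
  (1 : Matrix (Fin N) (Fin N) ℝ) ⊗ₖ R

/-- The commutant subalgebra `𝔥 = {X ∈ 𝔰𝔬(4N) | ∀ m, [1_{N × N} ⊗ R_m, X] = 0}`, where `𝔰𝔬(4N)` is
realized by the skew-symmetric matrices with rows and columns indexed by `Fin N × Fin 4`. -/
def commutant {M : ℕ} (N : ℕ) (R : Fin M → Matrix (Fin 4) (Fin 4) ℝ) :
    LieSubalgebra ℝ (LieAlgebra.Orthogonal.so (Fin N × Fin 4) ℝ) where
  carrier := {X | ∀ m, ⁅hat N (R m), (X : Matrix (Fin N × Fin 4) (Fin N × Fin 4) ℝ)⁆ = 0}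
  zero_mem' := fun m => by simp
  add_mem' := fun {X Y} hX hY m => by
    have h1 := hX m
    have h2 := hY m
    simp [h1, h2]
  smul_mem' := fun c X hX m => by
    have h1 := hX m
    simp [h1]
  lie_mem' := fun {X Y} hX hY m => by
    have h1 := hX m
    have h2 := hY m
    rw [LieSubalgebra.coe_bracket, leibniz_lie, h1, h2]
    simp

/-- Anti-Hermitian `n × n` matrices over a real star algebra `D`, with the commutator bracket. -/
def antiHermitian (n : ℕ) (D : Type) [Ring D] [StarRing D] [Algebra ℝ D] [StarModule ℝ D] :
    LieSubalgebra ℝ (Matrix (Fin n) (Fin n) D) where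
  carrier := {X | star X = -X}
  zero_mem' := by simp
  add_mem' := fun {X Y} hX hY => by
    have h1 : star X = -X := hX
    have h2 : star Y = -Y := hY
    change star (X + Y) = -(X + Y)
    rw [star_add, h1, h2, neg_add]
  smul_mem' := fun c X hX => by
    have h1 : star X = -X := hX
    change star (c • X) = -(c • X)
    rw [star_smul, h1, star_trivial, smul_neg]
  lie_mem' := fun {X Y} hX hY => by
    have h1 : star X = -X := hX
    have h2 : star Y = -Y := hY
    change star ⁅X, Y⁆ = -⁅X, Y⁆
    rw [LieRing.of_associative_ring_bracket, star_sub, star_mul, star_mul, h1, h2]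
    noncomm_ring

/-- `𝔰𝔬(n)`: real skew-symmetric matrices. -/
abbrev so (n : ℕ) : LieSubalgebra ℝ (Matrix (Fin n) (Fin n) ℝ) :=
  LieAlgebra.Orthogonal.so (Fin n) ℝ

/-- `𝔲(n)`: complex anti-Hermitian matrices, as a real Lie algebra. -/
noncomputable abbrev u (n : ℕ) : LieSubalgebra ℝ (Matrix (Fin n) (Fin n) ℂ) :=
  antiHermitian n ℂ

instance : StarModule ℝ ℍ[ℝ] := ⟨fun r q => by ext <;> simp⟩

/-- The compact `𝔰𝔭(n)`: quaternionic anti-Hermitian matrices, as a real Lie algebra. -/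
noncomputable abbrev sp (n : ℕ) : LieSubalgebra ℝ (Matrix (Fin n) (Fin n) ℍ[ℝ]) :=
  antiHermitian n ℍ[ℝ]

section Types

variable {A : Subalgebra ℝ (Matrix (Fin 4) (Fin 4) ℝ)} (ρ : Submodule A V)

/-- The endomorphism algebra of the module `ρ` is `ℝ`. -/
def IsRealType : Prop := Nonempty (Module.End A ρ ≃ₐ[ℝ] ℝ)

/-- The endomorphism algebra of the module `ρ` is `ℂ`. -/
def IsComplexType : Prop := Nonempty (Module.End A ρ ≃ₐ[ℝ] ℂ)

/-- The endomorphism algebra of the module `ρ` is `ℍ`. -/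
def IsQuaternionicType : Prop := Nonempty (Module.End A ρ ≃ₐ[ℝ] ℍ[ℝ])

end Types

/-- A decomposition of the `A`-module `ℝ⁴` into irreducible modules, grouped by isomorphism class
and by type: pairwise non-isomorphic irreducible modules `ρ` of real, complex and quaternionic type
with positive multiplicities `m`, and an isomorphism of `ℝ⁴` with the direct sum of all `ρ^{⊕ m}`.
Each representative `ρ` is taken to be a submodule of `ℝ⁴`; as `m > 0`, this loses nothing. -/
structure IrrepDecomposition (A : Subalgebra ℝ (Matrix (Fin 4) (Fin 4) ℝ)) where
  /-- The numbers of real, complex and quaternionic modules up to isomorphism. -/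
  (numR numC numH : ℕ)
  ρR : Fin numR → Submodule A V
  ρC : Fin numC → Submodule A V
  ρH : Fin numH → Submodule A V
  mR : Fin numR → ℕ
  mC : Fin numC → ℕ
  mH : Fin numH → ℕ
  mR_pos : ∀ j, 0 < mR j
  mC_pos : ∀ j, 0 < mC j
  mH_pos : ∀ j, 0 < mH j
  simpleR : ∀ j, IsSimpleModule A (ρR j)
  simpleC : ∀ j, IsSimpleModule A (ρC j)
  simpleH : ∀ j, IsSimpleModule A (ρH j)
  typeR : ∀ j, IsRealType (ρR j)
  typeC : ∀ j, IsComplexType (ρC j)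
  typeH : ∀ j, IsQuaternionicType (ρH j)
  distinctR : ∀ i j, i ≠ j → IsEmpty (ρR i ≃ₗ[A] ρR j)
  distinctC : ∀ i j, i ≠ j → IsEmpty (ρC i ≃ₗ[A] ρC j)
  distinctH : ∀ i j, i ≠ j → IsEmpty (ρH i ≃ₗ[A] ρH j)
  iso : Nonempty (V ≃ₗ[A]
    (⨁ j, (Fin (mR j) → ρR j)) × (⨁ j, (Fin (mC j) → ρC j)) × (⨁ j, (Fin (mH j) → ρH j)))

end GNY

/-! Let C be the commutant of 𝒜 in the 4 × 4 matrices, that is, the endomorphism algebra of the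
module ℝ⁴. A matrix commutes with all 1 ⊗ R_m exactly when each of its 4 × 4 blocks lies in C, so 𝔥
is the Lie algebra of skew-adjoint N × N matrices over C (`mem_range_blockHom_iff`).

As 𝒜 is stable under transposition, so is C, and orthogonal complements of submodules are
submodules; hence ℝ⁴ is semisimple. If p projects orthogonally onto a simple ρ, the corner p C p is
End(ρ), a finite-dimensional real division algebra with an involution. Positivity of the trace makes
its self-adjoint elements scalars (`exists_scalar_of_adjoint_eq`). Frobenius' argument then leaves
only ℝ, ℂ and ℍ, and any identification with one of these carries the involution to conjugation
(`algEquiv_adjoint`).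

A given decomposition of ℝ⁴ need not be orthogonal, but polar decomposition makes it so
(`exists_isometries`). The resulting isometries cut a skew-adjoint matrix over C into blocks. By
Schur's lemma the blocks between non-isomorphic modules vanish, and the block of ρ^{⊕ m} is an
arbitrary anti-Hermitian matrix of size mN over ℝ, ℂ or ℍ (`exists_lieHom_of_isometries`). -/

namespace GNY

/-! ### Frobenius' theorem for algebras with a positive involution -/

section Frobenius

variable {D : Type*} [Ring D] [NoZeroDivisors D] [Algebra ℝ D]

/-- A nonzero element whose square is a nonpositive scalar can be rescaled to a square root
of `-1`. -/
theorem exists_smul_mul_self_eq_neg_one {y : D} (hy : y ≠ 0) {c : ℝ} (hc : 0 ≤ c)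
    (h : y * y = algebraMap ℝ D (-c)) :
    ∃ t : ℝ, t ≠ 0 ∧ (t • y) * (t • y) = -1 := by
  have hc0 : c ≠ 0 := by
    rintro rfl
    simp [hy] at h
  have hcpos : 0 < c := lt_of_le_of_ne hc hc0.symm
  refine ⟨(√c)⁻¹, by positivity, ?_⟩
  rw [smul_mul_smul_comm, h, Algebra.algebraMap_eq_smul_one, smul_smul, ← mul_inv,
    Real.mul_self_sqrt hc]
  simp [hc0]

variable [Nontrivial D] (σ : D →ₗ[ℝ] D) (hmul : ∀ x y, σ (x * y) = σ y * σ x) (hinv : ∀ x, σ (σ x) = x)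
  (hsym : ∀ x, σ x = x → ∃ r : ℝ, x = algebraMap ℝ D r)
  (hpos : ∀ x, ∃ r : ℝ, 0 ≤ r ∧ σ x * x = algebraMap ℝ D r)

include hmul hinv hsym hpos in
/-- Frobenius' theorem for real division algebras with a positive involution. -/
theorem nonempty_algEquiv_of_involution :
    Nonempty (D ≃ₐ[ℝ] ℝ) ∨ Nonempty (D ≃ₐ[ℝ] ℂ) ∨ Nonempty (D ≃ₐ[ℝ] ℍ[ℝ]) := by
  have h2 (y : D) (h : y = -y) : y = 0 := by
    have h3 : (2 : ℝ) • y = 0 := by rw [two_smul]; nth_rw 1 [h]; simp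
    simpa using h3
  have hone : σ 1 = 1 := by
    have := hmul 1 (σ 1)
    simpa [hinv] using this.symm
  have hsplit (x : D) : ∃ (r : ℝ) (y : D), σ y = -y ∧ x = algebraMap ℝ D r + y := by
    obtain ⟨r, hr⟩ := hsym ((2⁻¹ : ℝ) • (x + σ x)) (by simp [hinv, add_comm])
    refine ⟨r, (2⁻¹ : ℝ) • (x - σ x), by simp [hinv, ← smul_neg], ?_⟩
    rw [← hr, ← smul_add, add_add_sub_cancel, ← two_smul ℝ x, smul_smul]
    norm_num
  have hunit (y : D) (hy : σ y = -y) (hy0 : y ≠ 0) : ∃ t : ℝ, t ≠ 0 ∧ (t • y) * (t • y) = -1 := by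
    obtain ⟨r, hr, h⟩ := hpos y
    refine exists_smul_mul_self_eq_neg_one hy0 hr ?_
    rw [map_neg, ← h, hy]
    simp
  -- the part of a skew element that anticommutes with a given imaginary unit
  have hproj (i y : D) (hi : σ i = -i) (hi2 : i * i = -1) (hy : σ y = -y) :
      ∃ t : ℝ, i * (y - t • i) = -((y - t • i) * i) := by
    -- The anticommutator of two skew elements is self-adjoint, hence a scalar `s`. Replacing `y` by
    -- `y - t • i` adds `2 * t` to it, as `i * i = -1`, so `t = -s / 2` makes it vanish.
    obtain ⟨s, hs⟩ := hsym (i * y + y * i) (by simp [hmul, hi, hy, add_comm])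
    refine ⟨-s / 2, ?_⟩
    rw [eq_neg_iff_add_eq_zero, mul_sub, sub_mul, mul_smul_comm, smul_mul_assoc, hi2,
      sub_add_sub_comm, hs, Algebra.algebraMap_eq_smul_one, ← two_smul ℝ, smul_smul, smul_neg,
      sub_neg_eq_add, ← add_smul]
    ring_nf
    simp
  by_cases hR : ∀ y, σ y = -y → y = 0
  · left
    refine ⟨(AlgEquiv.ofBijective (Algebra.ofId ℝ D)
      ⟨(algebraMap ℝ D).injective, fun x => ?_⟩).symm⟩
    obtain ⟨r, y, hy, rfl⟩ := hsplit x
    exact ⟨r, by simp [hR y hy, Algebra.ofId_apply]⟩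
  push Not at hR
  obtain ⟨i₀, hi₀, hi₀0⟩ := hR
  obtain ⟨t, -, hi2⟩ := hunit i₀ hi₀ hi₀0
  obtain ⟨i, hi, hi2⟩ : ∃ i, σ i = -i ∧ i * i = -1 := ⟨t • i₀, by simp [hi₀], hi2⟩
  by_cases hC : ∀ y, σ y = -y → ∃ t : ℝ, y = t • i
  · right; left
    refine ⟨(AlgEquiv.ofBijective (Complex.liftAux i hi2) ⟨RingHom.injective
      (Complex.liftAux i hi2).toRingHom, fun x => ?_⟩).symm⟩
    obtain ⟨r, y, hy, rfl⟩ := hsplit x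
    obtain ⟨t, rfl⟩ := hC y hy
    exact ⟨⟨r, t⟩, by simp [Complex.liftAux_apply]⟩
  push Not at hC
  obtain ⟨y, hy, hyi⟩ := hC
  obtain ⟨s, hs⟩ := hproj i y hi hi2 hy
  obtain ⟨t', ht', hj2⟩ := hunit (y - s • i) (by rw [map_sub, map_smul, hy, hi, smul_neg]; abel) (sub_ne_zero.2 (hyi s))
  set j := t' • (y - s • i) with hjdef
  have hj : σ j = -j := by
    rw [hjdef, map_smul, map_sub, map_smul, hy, hi, ← smul_neg, smul_neg s i]
    congr 1
    abel
  have hij : j * i = -(i * j) := by simp [hjdef, hs]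
  have hk : σ (i * j) = -(i * j) := by rw [hmul, hi, hj, neg_mul_neg, hij]
  have hk2 : (i * j) * (i * j) = -1 := by
    rw [mul_assoc, ← mul_assoc j, hij, neg_mul, mul_assoc i j j, hj2]
    simp [hi2]
  let B : QuaternionAlgebra.Basis D (-1 : ℝ) 0 (-1) :=
    { i := i, j := j, k := i * j, i_mul_i := by simp [hi2], j_mul_j := by simp [hj2]
      i_mul_j := rfl, j_mul_i := by simp [hij] }
  right; right
  let F : ℍ[ℝ] →ₐ[ℝ] D := B.liftHom
  refine ⟨(AlgEquiv.ofBijective F ⟨RingHom.injective F.toRingHom, fun x => ?_⟩).symm⟩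
  obtain ⟨r, y, hy, rfl⟩ := hsplit x
  obtain ⟨a, ha⟩ := hproj i y hi hi2 hy
  obtain ⟨b, hb⟩ := hproj j y hj hj2 hy
  obtain ⟨c, hc⟩ := hproj (i * j) y hk hk2 hy
  -- The units `i`, `j`, `i * j` anticommute pairwise, so removing one component does not disturb
  -- anticommutation with the other two, and `z` anticommutes with all three. But anticommuting with
  -- `i` and `j` implies commuting with `i * j`, so `z = 0`.
  set z := y - a • i - b • j - c • (i * j) with hz
  have e2 : i * (i * j) = -j := by rw [← mul_assoc, hi2]; simp
  have e3 : (i * j) * i = j := by rw [mul_assoc, hij, mul_neg, e2, neg_neg]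
  have e4 : (i * j) * j = -i := by rw [mul_assoc, hj2]; simp
  have e5 : j * (i * j) = i := by rw [← mul_assoc, hij, neg_mul, e4, neg_neg]
  have anti (m u v : D) (t : ℝ) (hu : m * u = -(u * m)) (hv : m * v = -(v * m)) :
      m * (u - t • v) = -((u - t • v) * m) := by
    rw [mul_sub, sub_mul, hu, mul_smul_comm, smul_mul_assoc, hv, smul_neg]
    abel
  have zi : i * z = -(z * i) :=
    anti _ _ _ _ (anti _ _ _ _ ha (by rw [hij, neg_neg])) (by rw [e2, e3])
  have zj : j * z = -(z * j) := by
    have : z = y - b • j - a • i - c • (i * j) := by rw [hz]; abel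
    rw [this]
    exact anti _ _ _ _ (anti _ _ _ _ hb hij) (by rw [e4, e5, neg_neg])
  have zk : (i * j) * z = -(z * (i * j)) := by
    have : z = y - c • (i * j) - a • i - b • j := by rw [hz]; abel
    rw [this]
    exact anti _ _ _ _ (anti _ _ _ _ hc (by rw [e3, e2, neg_neg])) (by rw [e4, e5])
  have zk' : (i * j) * z = z * (i * j) := by
    rw [mul_assoc, zj, mul_neg, ← mul_assoc, zi, neg_mul, neg_neg, mul_assoc]
  have hz0 : z = 0 := by
    have h := h2 ((i * j) * z) (zk.trans (congrArg Neg.neg zk'.symm))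
    have hk0 : i * j ≠ 0 := by
      intro h0
      simp [h0] at hk2
    exact (mul_eq_zero.1 h).resolve_left hk0
  refine ⟨⟨r, a, b, c⟩, ?_⟩
  change algebraMap ℝ D r + a • i + b • j + c • (i * j) = _
  have : y = a • i + b • j + c • (i * j) := by
    rw [← sub_eq_zero, ← hz0, hz]; abel
  rw [this]; abel

end Frobenius

/-- This and its analogues for ℂ and ℍ describe skewness by multiplication alone. If `y` had nonzero
real part, a real square would force `y` to be real, and the square would be positive. -/
theorem real_star_eq_neg {y : ℝ} {c : ℝ} (hc : 0 ≤ c) (h : y * y = algebraMap ℝ ℝ (-c)) :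
    star y = -y := by
  have : y = 0 := by
    have h' : y * y = -c := h
    nlinarith [mul_self_nonneg y, mul_self_eq_zero (a := y)]
  simp [this]

theorem complex_star_eq_neg {y : ℂ} {c : ℝ} (hc : 0 ≤ c) (h : y * y = algebraMap ℝ ℂ (-c)) :
    star y = -y := by
  have h1 := congrArg Complex.re h
  have h2 := congrArg Complex.im h
  simp at h1 h2
  have : y.re = 0 := by
    by_contra h0
    have : y.im = 0 := by
      have : y.re * y.im = 0 := by linarith
      exact (mul_eq_zero.1 this).resolve_left h0
    rw [this] at h1
    have := mul_self_pos.2 h0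
    linarith
  apply Complex.ext <;> simp [this]

theorem quaternion_star_eq_neg {y : ℍ[ℝ]} {c : ℝ} (hc : 0 ≤ c)
    (h : y * y = algebraMap ℝ ℍ[ℝ] (-c)) : star y = -y := by
  have h0 := congrArg QuaternionAlgebra.re h
  have h1 := congrArg QuaternionAlgebra.imI h
  have h2 := congrArg QuaternionAlgebra.imJ h
  have h3 := congrArg QuaternionAlgebra.imK h
  simp only [Quaternion.re_mul, Quaternion.imI_mul, Quaternion.imJ_mul, Quaternion.imK_mul,
    Quaternion.algebraMap_def, Quaternion.re_coe, Quaternion.imI_coe, Quaternion.imJ_coe,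
    Quaternion.imK_coe] at h0 h1 h2 h3
  have : y.re = 0 := by
    by_contra hr
    have hI : y.imI = 0 := (mul_eq_zero.1 (by linarith : y.re * y.imI = 0)).resolve_left hr
    have hJ : y.imJ = 0 := (mul_eq_zero.1 (by linarith : y.re * y.imJ = 0)).resolve_left hr
    have hK : y.imK = 0 := (mul_eq_zero.1 (by linarith : y.re * y.imK = 0)).resolve_left hr
    rw [hI, hJ, hK] at h0
    have := mul_self_pos.2 hr
    linarith
  ext <;> simp [this]

end GNY

/-! ### Corners of the endomorphism algebra and their involutions -/

namespace GNY

/-- An identification of the endomorphism algebra of a module with a real star algebra that has a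
positive trace and square roots of positive elements, for which every submodule is the image of a self-adjoint projection. -/
structure StarEnd (A V E : Type*) [Ring A] [Algebra ℝ A] [AddCommGroup V] [Module ℝ V]
    [Module A V] [IsScalarTower ℝ A V] [Ring E] [StarRing E] [Algebra ℝ E] where
  equiv : Module.End A V ≃ₐ[ℝ] E
  orthProj : ∀ ρ : Submodule A V, V →ₗ[A] ρ
  orthProj_coe : ∀ (ρ : Submodule A V) (v : ρ), orthProj ρ v = v
  star_orthProj : ∀ ρ : Submodule A V, star (equiv (ρ.subtype ∘ₗ orthProj ρ)) =
    equiv (ρ.subtype ∘ₗ orthProj ρ)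
  trace : E →ₗ[ℝ] ℝ
  trace_pos : ∀ x : E, x ≠ 0 → 0 < trace (star x * x)
  exists_sqrt : ∀ (ι : Type) [Fintype ι] (x : ι → E),
    ∃ q : E, star q = q ∧ q * q = ∑ i, star (x i) * x i

theorem isDomain_end {A W : Type*} [Ring A] [AddCommGroup W] [Module A W] [IsSimpleModule A W] :
    IsDomain (Module.End A W) := by
  classical exact inferInstance

theorem one_ne_zero_end {A W : Type*} [Ring A] [AddCommGroup W] [Module A W] [IsSimpleModule A W] :
    (1 : Module.End A W) ≠ 0 :=
  haveI := isDomain_end (A := A) (W := W)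
  one_ne_zero

namespace StarEnd

variable {A V E : Type*} [Ring A] [Algebra ℝ A] [AddCommGroup V] [Module ℝ V]
  [Module A V] [IsScalarTower ℝ A V] [Ring E] [StarRing E] [Algebra ℝ E] (S : StarEnd A V E)

attribute [simp] orthProj_coe

/-- A map of submodules, extended by zero to the orthogonal complement. -/
noncomputable def corner (ρ ρ' : Submodule A V) : (ρ →ₗ[A] ρ') →ₗ[ℝ] E where
  toFun f := S.equiv (ρ'.subtype ∘ₗ f ∘ₗ S.orthProj ρ)
  map_add' f g := by rw [← map_add, LinearMap.add_comp, LinearMap.comp_add]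
  map_smul' c f := by
    rw [RingHom.id_apply, ← map_smul]
    rfl

variable {ρ ρ' ρ'' : Submodule A V}

theorem corner_apply (f : ρ →ₗ[A] ρ') :
    S.corner ρ ρ' f = S.equiv (ρ'.subtype ∘ₗ f ∘ₗ S.orthProj ρ) := rfl

theorem corner_mul_corner (g : ρ' →ₗ[A] ρ'') (f : ρ →ₗ[A] ρ') :
    S.corner ρ' ρ'' g * S.corner ρ ρ' f = S.corner ρ ρ'' (g ∘ₗ f) := by
  simp only [corner_apply, ← map_mul]
  congr 1
  ext v
  simp

theorem corner_injective (ρ ρ' : Submodule A V) : Function.Injective (S.corner ρ ρ') := by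
  intro f g h
  ext v
  have := LinearMap.congr_fun (S.equiv.injective h) v.1
  simpa using this

/-- The orthogonal projection onto a submodule. -/
noncomputable def proj (ρ : Submodule A V) : E := S.corner ρ ρ LinearMap.id

theorem star_proj (ρ : Submodule A V) : star (S.proj ρ) = S.proj ρ := S.star_orthProj ρ

theorem corner_mul_proj (f : ρ →ₗ[A] ρ') : S.corner ρ ρ' f * S.proj ρ = S.corner ρ ρ' f :=
  S.corner_mul_corner _ _

theorem proj_mul_corner (f : ρ →ₗ[A] ρ') : S.proj ρ' * S.corner ρ ρ' f = S.corner ρ ρ' f :=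
  S.corner_mul_corner _ _

theorem proj_mul_proj (ρ : Submodule A V) : S.proj ρ * S.proj ρ = S.proj ρ :=
  S.corner_mul_proj _

/-- Compressing an endomorphism of `V` to a map `ρ → ρ'` identifies the Hom space with the corner of
`E` cut out by the two projections. -/
theorem exists_corner_eq (ρ ρ' : Submodule A V) (x : E) :
    ∃ f, S.corner ρ ρ' f = S.proj ρ' * x * S.proj ρ := by
  obtain ⟨x, rfl⟩ := S.equiv.surjective x
  refine ⟨S.orthProj ρ' ∘ₗ x ∘ₗ ρ.subtype, ?_⟩
  simp only [proj, corner_apply, ← map_mul]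
  congr 1

theorem proj_mul_mul_proj_eq_zero [IsSimpleModule A ρ] [IsSimpleModule A ρ']
    (h : IsEmpty (ρ ≃ₗ[A] ρ')) (x : E) : S.proj ρ' * x * S.proj ρ = 0 := by
  obtain ⟨f, hf⟩ := S.exists_corner_eq ρ ρ' x
  rcases LinearMap.bijective_or_eq_zero f with hb | rfl
  · exact h.elim (LinearEquiv.ofBijective f hb)
  · rw [← hf, map_zero]

theorem corner_mul (f g : Module.End A ρ) :
    S.corner ρ ρ (f * g) = S.corner ρ ρ f * S.corner ρ ρ g :=
  (S.corner_mul_corner f g).symm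

variable (ρ) in
include S in
theorem finiteDimensional_end [FiniteDimensional ℝ E] :
    FiniteDimensional ℝ (Module.End A ρ) :=
  Module.Finite.of_injective _ (S.corner_injective ρ ρ)

variable [StarModule ℝ E]

-- The projection is self-adjoint, so `star` preserves its corner and pulls back along the injective
-- `corner`.
variable (ρ) in
theorem exists_adjoint : ∃ σ : Module.End A ρ →ₗ[ℝ] Module.End A ρ,
    ∀ f, S.corner ρ ρ (σ f) = star (S.corner ρ ρ f) := by
  have h (f : Module.End A ρ) : ∃ g, S.corner ρ ρ g = star (S.corner ρ ρ f) := by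
    obtain ⟨g, hg⟩ := S.exists_corner_eq ρ ρ (star (S.corner ρ ρ f))
    refine ⟨g, ?_⟩
    rw [hg, ← S.star_proj, ← star_mul, S.corner_mul_proj, S.star_proj, ← S.star_proj, ← star_mul,
      S.proj_mul_corner]
  choose σ hσ using h
  refine ⟨⟨⟨σ, fun f g => S.corner_injective _ _ ?_⟩, fun c f => S.corner_injective _ _ ?_⟩, hσ⟩
  · simp [hσ]
  · simp [hσ]

/-- The involution on the endomorphism algebra of a submodule. -/
noncomputable def adjoint (ρ : Submodule A V) : Module.End A ρ →ₗ[ℝ] Module.End A ρ :=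
  (S.exists_adjoint ρ).choose

theorem corner_adjoint (f : Module.End A ρ) :
    S.corner ρ ρ (S.adjoint ρ f) = star (S.corner ρ ρ f) :=
  (S.exists_adjoint ρ).choose_spec f

theorem adjoint_adjoint (f : Module.End A ρ) : S.adjoint ρ (S.adjoint ρ f) = f :=
  S.corner_injective _ _ (by rw [corner_adjoint, corner_adjoint, star_star])

theorem adjoint_mul (f g : Module.End A ρ) :
    S.adjoint ρ (f * g) = S.adjoint ρ g * S.adjoint ρ f :=
  S.corner_injective _ _ (by
    rw [corner_mul, corner_adjoint, corner_adjoint, corner_adjoint, corner_mul, star_mul])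

theorem adjoint_one : S.adjoint ρ 1 = 1 :=
  S.corner_injective _ _ ((S.corner_adjoint _).trans (S.star_proj ρ))

theorem trace_corner_pos {f : Module.End A ρ} (hf : f ≠ 0) :
    0 < S.trace (S.corner ρ ρ (S.adjoint ρ f * f)) := by
  rw [corner_mul, corner_adjoint]
  refine S.trace_pos _ fun h => hf (S.corner_injective _ _ ?_)
  rw [h, map_zero]

variable [FiniteDimensional ℝ E] [IsSimpleModule A ρ]

/-- A self-adjoint non-scalar would have an irreducible quadratic minimal polynomial. Completing the
square gives a nonzero self-adjoint `g` with `g * g` a negative scalar, contradicting positivity of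
the trace on `g * g` and on `1`. -/
theorem exists_scalar_of_adjoint_eq (f : Module.End A ρ) (hf : S.adjoint ρ f = f) :
    ∃ r : ℝ, f = algebraMap ℝ _ r := by
  have := isDomain_end (A := A) (W := ρ)
  have := S.finiteDimensional_end ρ
  have hint : IsIntegral ℝ f := IsIntegral.of_finite ℝ f
  have hirr := minpoly.irreducible hint
  by_contra hne
  have hdeg : 2 ≤ (minpoly ℝ f).natDegree :=
    (minpoly.two_le_natDegree_iff hint).2 fun ⟨r, hr⟩ => hne ⟨r, hr.symm⟩
  have hdeg' : (minpoly ℝ f).natDegree = 2 :=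
    le_antisymm (Polynomial.natDegree_le_of_degree_le hirr.degree_le_two) hdeg
  set b := (minpoly ℝ f).coeff 1
  set c := (minpoly ℝ f).coeff 0
  have hp : minpoly ℝ f = Polynomial.X ^ 2 + Polynomial.C b * Polynomial.X + Polynomial.C c := by
    have h1 := (minpoly.monic hint).coeff_natDegree
    rw [hdeg'] at h1
    ext n
    rcases n with _ | _ | _ | n
    · simp [c]
    · simp [b, Polynomial.coeff_C]
    · simp [h1]
    · rw [Polynomial.coeff_eq_zero_of_natDegree_lt (by omega)]
      simp [Polynomial.coeff_X_pow]
  have hdisc : b ^ 2 - 4 * c < 0 := by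
    by_contra hge
    have hroot : (minpoly ℝ f).IsRoot ((-b + √(b ^ 2 - 4 * c)) / 2) := by
      rw [hp]
      simp only [Polynomial.IsRoot, Polynomial.eval_add, Polynomial.eval_mul, Polynomial.eval_pow,
        Polynomial.eval_X, Polynomial.eval_C]
      nlinarith [Real.sq_sqrt (not_lt.1 hge)]
    have h1 := Polynomial.natDegree_eq_of_degree_eq_some
      (Polynomial.degree_eq_one_of_irreducible_of_root hirr hroot)
    rw [hdeg'] at h1
    exact absurd h1 (by norm_num)
  have hz := minpoly.aeval ℝ f
  rw [hp] at hz
  simp only [map_add, map_mul, map_pow, Polynomial.aeval_X, Polynomial.aeval_C,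
    Algebra.algebraMap_eq_smul_one, smul_mul_assoc, one_mul] at hz
  set g := f + (b / 2) • (1 : Module.End A ρ) with hg
  have hgadj : S.adjoint ρ g = g := by rw [hg, map_add, map_smul, hf, adjoint_one]
  have hgsq : g * g = -((4 * c - b ^ 2) / 4) • (1 : Module.End A ρ) := by
    have : g * g = (f ^ 2 + b • f + c • 1) - ((4 * c - b ^ 2) / 4) • (1 : Module.End A ρ) := by
      rw [hg, add_mul, mul_add, mul_add, smul_mul_smul_comm, mul_smul_comm, smul_mul_assoc]
      simp only [mul_one, one_mul, sq]
      module
    rw [this, hz, zero_sub]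
    exact (neg_smul _ _).symm
  have hg0 : g ≠ 0 := fun h0 => hne ⟨-(b / 2), by
    rw [Algebra.algebraMap_eq_smul_one, neg_smul, ← add_eq_zero_iff_eq_neg]
    exact h0⟩
  have h1 := S.trace_corner_pos hg0
  have h2 := S.trace_corner_pos (one_ne_zero_end (A := A) (W := ρ))
  rw [hgadj, hgsq, map_smul, map_smul, smul_eq_mul] at h1
  rw [adjoint_one, one_mul] at h2
  nlinarith

/-- The product is self-adjoint, hence scalar; comparing its trace with that of `1` gives the sign.
-/
theorem exists_adjoint_mul_self_eq (f : Module.End A ρ) :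
    ∃ r : ℝ, 0 ≤ r ∧ S.adjoint ρ f * f = algebraMap ℝ _ r := by
  obtain ⟨r, hr⟩ := S.exists_scalar_of_adjoint_eq (S.adjoint ρ f * f)
    (by rw [adjoint_mul, adjoint_adjoint])
  refine ⟨r, ?_, hr⟩
  by_cases hf : f = 0
  · have h0 : (algebraMap ℝ (Module.End A ρ)) r = 0 := by rw [← hr, hf, mul_zero]
    have := isDomain_end (A := A) (W := ρ)
    exact ((map_eq_zero (algebraMap ℝ (Module.End A ρ))).1 h0).ge
  · have h1 := S.trace_corner_pos hf
    have h2 := S.trace_corner_pos (one_ne_zero_end (A := A) (W := ρ))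
    rw [hr, Algebra.algebraMap_eq_smul_one, map_smul, map_smul, smul_eq_mul] at h1
    rw [adjoint_one, one_mul] at h2
    exact (pos_of_mul_pos_left h1 h2.le).le

variable (ρ) in
include S in
theorem nonempty_algEquiv : Nonempty (Module.End A ρ ≃ₐ[ℝ] ℝ) ∨
    Nonempty (Module.End A ρ ≃ₐ[ℝ] ℂ) ∨ Nonempty (Module.End A ρ ≃ₐ[ℝ] ℍ[ℝ]) :=
  haveI := isDomain_end (A := A) (W := ρ)
  nonempty_algEquiv_of_involution (S.adjoint ρ) S.adjoint_mul S.adjoint_adjoint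
    S.exists_scalar_of_adjoint_eq S.exists_adjoint_mul_self_eq

/-- An identification of the endomorphism algebra of a simple submodule with `ℝ`, `ℂ` or `ℍ`
automatically preserves the involutions. -/
theorem algEquiv_adjoint {D : Type*} [Ring D] [StarRing D] [Algebra ℝ D] [StarModule ℝ D]
    (hD : ∀ (y : D) (c : ℝ), 0 ≤ c → y * y = algebraMap ℝ D (-c) → star y = -y)
    (φ : Module.End A ρ ≃ₐ[ℝ] D) (f : Module.End A ρ) : φ (S.adjoint ρ f) = star (φ f) := by
  -- A skew element has a nonpositive scalar square, a property every algebra isomorphism preserves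
  -- and which by `hD` implies skewness in `D`. Since `f + S.adjoint ρ f` is scalar and `f -
  -- S.adjoint ρ f` is skew, this settles every `f`.
  have skew (g : Module.End A ρ) (hg : S.adjoint ρ g = -g) : star (φ g) = -φ g := by
    obtain ⟨c, hc, h⟩ := S.exists_adjoint_mul_self_eq g
    refine hD _ c hc ?_
    have e : g * g = -(S.adjoint ρ g * g) := by
      rw [hg]
      exact (neg_eq_iff_eq_neg.2 (neg_mul g g)).symm
    rw [← map_mul, map_neg, ← φ.commutes, ← h, e, map_neg]
  obtain ⟨r, hr⟩ := S.exists_scalar_of_adjoint_eq (f + S.adjoint ρ f)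
    (by rw [map_add, adjoint_adjoint, add_comm])
  have hd := skew (f - S.adjoint ρ f) (by rw [map_sub, adjoint_adjoint, neg_sub])
  have hs : star (φ f) + star (φ (S.adjoint ρ f)) = φ f + φ (S.adjoint ρ f) := by
    rw [← star_add, ← map_add, hr, φ.commutes, ← algebraMap_star_comm, star_trivial]
  rw [map_sub, star_sub] at hd
  have h2 : (2 : ℝ) • φ (S.adjoint ρ f) = (2 : ℝ) • star (φ f) := by
    have h3 : φ f + φ (S.adjoint ρ f) + -(φ f - φ (S.adjoint ρ f)) =
        star (φ f) + star (φ (S.adjoint ρ f)) + (star (φ f) - star (φ (S.adjoint ρ f))) := by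
      rw [hs, hd]
    rw [two_smul, two_smul]
    calc _ = φ f + φ (S.adjoint ρ f) + -(φ f - φ (S.adjoint ρ f)) := by abel
      _ = _ := h3
      _ = _ := by abel
  exact smul_right_injective D (two_ne_zero (α := ℝ)) h2

/-- The embedding of the endomorphism algebra of a simple submodule as a corner of `E`. -/
noncomputable def cornerEmbedding {D : Type*} [Ring D] [StarRing D] [Algebra ℝ D] [StarModule ℝ D]
    (hD : ∀ (y : D) (c : ℝ), 0 ≤ c → y * y = algebraMap ℝ D (-c) → star y = -y)
    (φ : Module.End A ρ ≃ₐ[ℝ] D) : D →⋆ₙₐ[ℝ] E where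
  toFun d := S.corner ρ ρ (φ.symm d)
  map_zero' := by simp
  map_add' x y := by simp
  map_smul' c x := by simp
  map_mul' x y := by rw [map_mul, corner_mul]
  map_star' x := by
    obtain ⟨f, rfl⟩ := φ.surjective x
    rw [← S.algEquiv_adjoint hD, φ.symm_apply_apply, φ.symm_apply_apply, corner_adjoint]

end StarEnd

end GNY

/-! ### Orthogonalizing a decomposition -/

namespace GNY

namespace StarEnd

variable {A V E : Type*} [Ring A] [Algebra ℝ A] [AddCommGroup V] [Module ℝ V]
  [Module A V] [IsScalarTower ℝ A V] [Ring E] [StarRing E] [Algebra ℝ E] (S : StarEnd A V E)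

/-- A decomposition of a module into a direct sum of submodules can be made orthogonal, by
polar decomposition. -/
theorem exists_isometries {ι : Type} [Fintype ι] [DecidableEq ι] (τ : ι → Submodule A V)
    (φ : V ≃ₗ[A] ∀ a, τ a) : ∃ u : ι → E, (∀ a, u a * S.proj (τ a) = u a) ∧
      (∀ a, star (u a) * u a = S.proj (τ a)) ∧ (∀ a b, a ≠ b → star (u a) * u b = 0) ∧
      ∑ a, u a * star (u a) = 1 := by
  -- `F a` and `G a` are the inclusion and the coordinate map of the summand `a`, extended to
  -- endomorphisms of `V`.
  let F (a : ι) : E :=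
    S.equiv (φ.symm.toLinearMap ∘ₗ LinearMap.single A (fun a => τ a) a ∘ₗ S.orthProj (τ a))
  let G (a : ι) : E := S.equiv ((τ a).subtype ∘ₗ LinearMap.proj a ∘ₗ φ.toLinearMap)
  have hp (a : ι) : S.proj (τ a) = S.equiv ((τ a).subtype ∘ₗ S.orthProj (τ a)) := rfl
  have hFp (a : ι) : F a * S.proj (τ a) = F a := by
    simp only [F, hp, ← map_mul]
    congr 1
    ext v
    simp
  have hpG (a : ι) : S.proj (τ a) * G a = G a := by
    simp only [G, hp, ← map_mul]
    congr 1
    ext v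
    simp
  have hGF (a : ι) : G a * F a = S.proj (τ a) := by
    simp only [F, G, hp, ← map_mul]
    congr 1
    ext v
    simp
  have hGF0 (a b : ι) (h : a ≠ b) : G a * F b = 0 := by
    simp only [F, G, ← map_mul]
    rw [← map_zero S.equiv]
    congr 1
    ext v
    simp [h]
  have hFG : ∑ a, F a * G a = 1 := by
    simp only [F, G, ← map_mul]
    rw [← map_sum, ← map_one S.equiv]
    congr 1
    ext v
    apply φ.injective
    rw [LinearMap.sum_apply, map_sum]
    simp only [Module.End.mul_apply, LinearMap.comp_apply, Submodule.subtype_apply, orthProj_coe,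
      LinearEquiv.coe_coe, LinearEquiv.apply_symm_apply, LinearMap.proj_apply,
      Module.End.one_apply]
    exact LinearMap.sum_single_apply (φ := fun a => τ a) (φ v)
  -- `q * q` is the Gram operator of the inner product that makes the given summands orthogonal, so
  -- `q` carries that inner product to the original one and the `q * F a` are orthogonal partial
  -- isometries.
  obtain ⟨q, hq, hqq⟩ := S.exists_sqrt ι G
  have hSF (b : ι) : (q * q) * F b = star (G b) * S.proj (τ b) := by
    rw [hqq, Finset.sum_mul, Finset.sum_eq_single b]
    · rw [mul_assoc, hGF]
    · intro a _ hab
      rw [mul_assoc, hGF0 a b hab, mul_zero]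
    · simp
  have hT : (q * q) * ∑ b, F b * star (F b) = 1 := by
    rw [Finset.mul_sum, ← star_one E, ← hFG, star_sum]
    refine Finset.sum_congr rfl fun b _ => ?_
    rw [← mul_assoc, hSF, star_mul, mul_assoc]
    congr 1
    nth_rw 2 [← hFp]
    rw [star_mul, S.star_proj]
  have hT' : (∑ b, F b * star (F b)) * (q * q) = 1 := by
    have h := congrArg star hT
    simpa [star_sum, hq] using h
  have key (a b : ι) : star (q * F a) * (q * F b) = star (G b * F a) * S.proj (τ b) := by
    rw [star_mul, hq, mul_assoc, ← mul_assoc q, hSF, ← mul_assoc, star_mul]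
  refine ⟨fun a => q * F a, fun a => ?_, fun a => ?_, fun a b h => ?_, ?_⟩
  · rw [mul_assoc, hFp]
  · rw [key, hGF, S.star_proj, S.proj_mul_proj]
  · rw [key, hGF0 b a h.symm, star_zero, zero_mul]
  -- `T` is the two-sided inverse of `q * q`, so it commutes with `q`.
  · set T := ∑ b, F b * star (F b) with hTdef
    have hqT : q * T = T * q :=
      calc q * T = (T * (q * q)) * (q * T) := by rw [hT', one_mul]
        _ = T * q * ((q * q) * T) := by simp only [mul_assoc]
        _ = T * q := by rw [hT, mul_one]
    calc ∑ a, q * F a * star (q * F a) = q * T * q := by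
          rw [hTdef, Finset.mul_sum, Finset.sum_mul]
          refine Finset.sum_congr rfl fun a _ => ?_
          rw [star_mul, hq]
          simp only [mul_assoc]
      _ = 1 := by rw [hqT, mul_assoc, hT']

end StarEnd

/-! ### Skew-adjoint matrices over corners and their assembly -/

section Blocks

variable {E : Type*} [Ring E] [StarRing E] [Algebra ℝ E]

/-- A representation of a Lie algebra by the skew-adjoint matrices over the corner of `E` cut out
by `p`. -/
def IsSkewCorner {L ι : Type*} [LieRing L] [LieAlgebra ℝ L] [Fintype ι] [DecidableEq ι] (p : E)
    (Γ : L →ₗ⁅ℝ⁆ Matrix ι ι E) : Prop :=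
  Function.Injective Γ ∧
    ∀ X, X ∈ Set.range Γ ↔ star X = -X ∧ Matrix.diagonal (fun _ => p) * X = X

/-- A family of representations of a Lie algebra that identifies it with the families of
skew-adjoint matrices over the corners of `E` cut out by the `p j`. -/
structure IsJointSkewCorner {L J : Type*} {ι : J → Type*} [LieRing L] [LieAlgebra ℝ L]
    [∀ j, Fintype (ι j)] [∀ j, DecidableEq (ι j)] (p : J → E)
    (Γ : ∀ j, L →ₗ⁅ℝ⁆ Matrix (ι j) (ι j) E) : Prop where
  skew : ∀ j z, star (Γ j z) = -Γ j z ∧ Matrix.diagonal (fun _ => p j) * Γ j z = Γ j z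
  eq_zero : ∀ z, (∀ j, Γ j z = 0) → z = 0
  exists_eq : ∀ X : ∀ j, Matrix (ι j) (ι j) E,
    (∀ j, star (X j) = -X j ∧ Matrix.diagonal (fun _ => p j) * X j = X j) → ∃ z, ∀ j, Γ j z = X j

theorem isJointSkewCorner_directSum {J : Type*} [Fintype J] {L ι : J → Type*}
    [∀ j, LieRing (L j)] [∀ j, LieAlgebra ℝ (L j)] [∀ j, Fintype (ι j)]
    [∀ j, DecidableEq (ι j)] {p : J → E} {Γ : ∀ j, L j →ₗ⁅ℝ⁆ Matrix (ι j) (ι j) E}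
    (h : ∀ j, IsSkewCorner (p j) (Γ j)) :
    IsJointSkewCorner p fun j => (Γ j).comp (DirectSum.lieAlgebraComponent ℝ J L j) where
  skew j z := ((h j).2 _).1 ⟨_, rfl⟩
  eq_zero z hz := by
    ext j
    exact (h j).1 ((hz j).trans (map_zero (Γ j)).symm)
  exists_eq X hX := by
    classical
    choose z hz using fun j => ((h j).2 (X j)).2 (hX j)
    refine ⟨(DirectSum.linearEquivFunOnFintype ℝ J L).symm z, fun j => ?_⟩
    rw [← hz j, LieHom.comp_apply]
    exact congrArg (Γ j) <| congrFun ((DirectSum.linearEquivFunOnFintype ℝ J L).apply_symm_apply z) j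

theorem isJointSkewCorner_prod {J₁ J₂ L₁ L₂ : Type*} {ι : J₁ ⊕ J₂ → Type*} [LieRing L₁]
    [LieAlgebra ℝ L₁] [LieRing L₂] [LieAlgebra ℝ L₂] [∀ j, Fintype (ι j)]
    [∀ j, DecidableEq (ι j)] {p : J₁ ⊕ J₂ → E}
    {Γ₁ : ∀ j, L₁ →ₗ⁅ℝ⁆ Matrix (ι (.inl j)) (ι (.inl j)) E}
    {Γ₂ : ∀ j, L₂ →ₗ⁅ℝ⁆ Matrix (ι (.inr j)) (ι (.inr j)) E}
    (h₁ : IsJointSkewCorner (ι := fun j => ι (.inl j)) (fun j => p (.inl j)) Γ₁)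
    (h₂ : IsJointSkewCorner (ι := fun j => ι (.inr j)) (fun j => p (.inr j)) Γ₂) :
    ∃ Γ : ∀ j, L₁ × L₂ →ₗ⁅ℝ⁆ Matrix (ι j) (ι j) E, IsJointSkewCorner p Γ := by
  refine ⟨fun j => match j with
    | .inl j => (Γ₁ j).comp (LieHom.fst ℝ L₁ L₂)
    | .inr j => (Γ₂ j).comp (LieHom.snd ℝ L₁ L₂), ⟨?_, ?_, ?_⟩⟩
  · rintro (j | j) z
    · exact h₁.skew j z.1
    · exact h₂.skew j z.2
  · intro z hz
    exact Prod.ext (h₁.eq_zero _ fun j => hz (.inl j)) (h₂.eq_zero _ fun j => hz (.inr j))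
  · intro X hX
    obtain ⟨z₁, hz₁⟩ := h₁.exists_eq (fun j => X (.inl j)) fun j => hX (.inl j)
    obtain ⟨z₂, hz₂⟩ := h₂.exists_eq (fun j => X (.inr j)) fun j => hX (.inr j)
    exact ⟨(z₁, z₂), fun j => match j with
      | .inl j => hz₁ j
      | .inr j => hz₂ j⟩

/-- Skew-Hermitian matrices over a star algebra embedded as a corner of `E`. -/
theorem exists_isSkewCorner {D : Type} [Ring D] [StarRing D] [Algebra ℝ D] [StarModule ℝ D]
    (γ : D →⋆ₙₐ[ℝ] E) (hγ : Function.Injective γ) {p : E} (hp : star p = p)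
    (hpγ : ∀ d, p * γ d = γ d) (hrange : ∀ x, p * x * p = x → x ∈ Set.range γ) {n : ℕ}
    (L : LieSubalgebra ℝ (Matrix (Fin n) (Fin n) D)) (hL : ∀ X, X ∈ L ↔ star X = -X)
    {ι : Type*} [Fintype ι] [DecidableEq ι] (e : ι ≃ Fin n) :
    ∃ Γ : L →ₗ⁅ℝ⁆ Matrix ι ι E, IsSkewCorner p Γ := by
  let Γ : L →ₗ⁅ℝ⁆ Matrix ι ι E :=
    { toFun := fun X => (X.1.submatrix e e).map γ
      map_add' := fun X Y => by
        ext a b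
        simp
      map_smul' := fun c X => by
        ext a b
        simp
      map_lie' := fun {X Y} => by
        ext a b
        simp only [LieSubalgebra.coe_bracket, LieRing.of_associative_ring_bracket,
          Matrix.map_apply, Matrix.submatrix_apply, Matrix.sub_apply, Matrix.mul_apply, map_sub,
          map_sum, map_mul]
        rw [← e.sum_comp, ← e.sum_comp] }
  have hΓ (X : L) (a b : ι) : Γ X a b = γ (X.1 (e a) (e b)) := rfl
  refine ⟨Γ, fun X Y h => ?_, fun X => ⟨?_, fun ⟨h1, h2⟩ => ?_⟩⟩
  · refine Subtype.ext (Matrix.ext fun a b => hγ ?_)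
    have := congrFun (congrFun h (e.symm a)) (e.symm b)
    simpa [hΓ] using this
  · rintro ⟨X, rfl⟩
    have hX := (hL X.1).1 X.2
    refine ⟨Matrix.ext fun a b => ?_, Matrix.ext fun a b => ?_⟩
    · rw [Matrix.star_apply, hΓ, Matrix.neg_apply, hΓ, ← map_star, ← map_neg]
      exact congrArg γ (congrFun (congrFun hX (e a)) (e b))
    · rw [Matrix.diagonal_mul, hΓ, hpγ]
  · have hl (a b : ι) : p * X a b = X a b := by
      have := congrFun (congrFun h2 a) b
      rwa [Matrix.diagonal_mul] at this
    have hs (a b : ι) : star (X b a) = -X a b := congrFun (congrFun h1 a) b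
    -- Taking adjoints turns `p * X = X` into `X * p = X` for skew `X`; the entries then lie in the
    -- corner of `p`, which is the range of `γ`.
    have hr (a b : ι) : X a b * p = X a b := by
      have := congrArg star (hl b a)
      rw [star_mul, hs, hp, neg_mul, neg_inj] at this
      exact this
    choose Z hZ using fun a b => hrange (X a b) (by rw [hl, hr])
    let W : Matrix (Fin n) (Fin n) D := fun a b => Z (e.symm a) (e.symm b)
    have hW : W ∈ L := (hL W).2 (Matrix.ext fun a b => hγ (by
      change γ (star (Z (e.symm b) (e.symm a))) = γ (-Z (e.symm a) (e.symm b))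
      rw [map_star, map_neg, hZ, hZ, hs]))
    refine ⟨⟨W, hW⟩, Matrix.ext fun a b => ?_⟩
    rw [hΓ]
    simp [W, hZ]

open Matrix in
/-- Assembling block matrices along a complete family of orthogonal isometries. -/
theorem exists_lieHom_of_isometries {L J n : Type*} [LieRing L] [LieAlgebra ℝ L] [Fintype J]
    [DecidableEq J] [Fintype n] [DecidableEq n] {ι : J → Type*} [∀ j, Fintype (ι j)]
    [∀ j, DecidableEq (ι j)] (p : J → E) (Γ : ∀ j, L →ₗ⁅ℝ⁆ Matrix (ι j) (ι j) E)
    (hΓ : IsJointSkewCorner p Γ)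
    (U : ∀ j, Matrix n (ι j) E) (hU : ∀ j, (U j)ᴴ * U j = diagonal (fun _ => p j))
    (hUp : ∀ j, U j * (diagonal (fun _ => p j) : Matrix (ι j) (ι j) E) = U j)
    (hU0 : ∀ i j, i ≠ j → ∀ Y : Matrix n n E, (U i)ᴴ * Y * U j = 0)
    (hU1 : ∑ j, U j * (U j)ᴴ = 1) :
    ∃ F : L →ₗ⁅ℝ⁆ Matrix n n E, Function.Injective F ∧
      ∀ Y, Y ∈ Set.range F ↔ star Y = -Y := by
  have hdiag (j : J) : (diagonal (fun _ : ι j => p j))ᴴ = diagonal (fun _ => p j) := by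
    rw [← hU, conjTranspose_mul, conjTranspose_conjTranspose]
  have hright (j : J) (X : Matrix (ι j) (ι j) E) (h1 : star X = -X)
      (h2 : diagonal (fun _ => p j) * X = X) : X * diagonal (fun _ => p j) = X := by
    have h := congrArg conjTranspose h2
    rw [conjTranspose_mul, hdiag] at h
    change star X * _ = star X at h
    rw [h1, neg_mul, neg_inj] at h
    exact h
  have hUU (i j : J) (h : i ≠ j) : (U i)ᴴ * U j = 0 := by
    simpa using hU0 i j h 1
  have hmul (z w : L) : (∑ i, U i * Γ i z * (U i)ᴴ) * (∑ j, U j * Γ j w * (U j)ᴴ) =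
      ∑ j, U j * (Γ j z * Γ j w) * (U j)ᴴ := by
    rw [Finset.sum_mul]
    refine Finset.sum_congr rfl fun i _ => ?_
    rw [Finset.mul_sum, Finset.sum_eq_single i]
    · calc U i * Γ i z * (U i)ᴴ * (U i * Γ i w * (U i)ᴴ)
          = U i * Γ i z * (((U i)ᴴ * U i) * Γ i w) * (U i)ᴴ := by simp only [Matrix.mul_assoc]
        _ = _ := by rw [hU, (hΓ.skew i w).2, Matrix.mul_assoc (U i)]
    · intro j _ hij
      calc U i * Γ i z * (U i)ᴴ * (U j * Γ j w * (U j)ᴴ)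
          = U i * Γ i z * ((U i)ᴴ * U j) * (Γ j w * (U j)ᴴ) := by simp only [Matrix.mul_assoc]
        _ = 0 := by rw [hUU i j hij.symm, Matrix.mul_zero, Matrix.zero_mul]
    · simp
  let F : L →ₗ⁅ℝ⁆ Matrix n n E :=
    { toFun := fun z => ∑ j, U j * Γ j z * (U j)ᴴ
      map_add' := fun z w => by
        simp only [map_add, Matrix.mul_add, Matrix.add_mul, Finset.sum_add_distrib]
      map_smul' := fun c z => by
        simp only [map_smul, Matrix.mul_smul, Matrix.smul_mul, Finset.smul_sum, RingHom.id_apply]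
      map_lie' := fun {z w} => by
        simp only [LieHom.map_lie, LieRing.of_associative_ring_bracket, hmul, Matrix.mul_sub,
          Matrix.sub_mul, Finset.sum_sub_distrib] }
  have hF (z : L) : F z = ∑ j, U j * Γ j z * (U j)ᴴ := rfl
  -- Compression by `U j` recovers the `j`-th block, which gives injectivity here and a preimage of
  -- each skew `Y` below.
  have hblock (z : L) (j : J) : (U j)ᴴ * F z * U j = Γ j z := by
    rw [hF, Matrix.mul_sum, Matrix.sum_mul, Finset.sum_eq_single j]
    · calc (U j)ᴴ * (U j * Γ j z * (U j)ᴴ) * U j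
          = ((U j)ᴴ * U j) * Γ j z * ((U j)ᴴ * U j) := by simp only [Matrix.mul_assoc]
        _ = _ := by rw [hU, (hΓ.skew j z).2, hright j _ (hΓ.skew j z).1 (hΓ.skew j z).2]
    · intro i _ hij
      calc (U j)ᴴ * (U i * Γ i z * (U i)ᴴ) * U j
          = ((U j)ᴴ * U i) * (Γ i z * (U i)ᴴ * U j) := by simp only [Matrix.mul_assoc]
        _ = 0 := by rw [hUU j i hij.symm, Matrix.zero_mul]
    · simp
  refine ⟨F, (injective_iff_map_eq_zero F).2 fun z hz => hΓ.eq_zero z fun j => ?_, fun Y => ⟨?_, ?_⟩⟩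
  · rw [← hblock, hz, Matrix.mul_zero, Matrix.zero_mul]
  · rintro ⟨z, rfl⟩
    rw [hF, star_sum, ← Finset.sum_neg_distrib]
    refine Finset.sum_congr rfl fun j _ => ?_
    have h := (hΓ.skew j z).1
    rw [star_eq_conjTranspose] at h ⊢
    rw [conjTranspose_mul, conjTranspose_mul, conjTranspose_conjTranspose, h, Matrix.neg_mul,
      Matrix.mul_neg, Matrix.mul_assoc]
  · intro hY
    rw [star_eq_conjTranspose] at hY
    obtain ⟨z, hz⟩ := hΓ.exists_eq (fun j => (U j)ᴴ * Y * U j) fun j => by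
      refine ⟨?_, ?_⟩
      · rw [star_eq_conjTranspose, conjTranspose_mul, conjTranspose_mul,
          conjTranspose_conjTranspose, hY, Matrix.neg_mul, Matrix.mul_neg, Matrix.mul_assoc]
      · have h := conjTranspose_mul (U j) (diagonal fun _ => p j)
        rw [hUp, hdiag] at h
        rw [← Matrix.mul_assoc, ← Matrix.mul_assoc, ← h]
    refine ⟨z, ?_⟩
    calc F z = ∑ j, U j * (U j)ᴴ * Y * (U j * (U j)ᴴ) := by
          rw [hF]
          refine Finset.sum_congr rfl fun j _ => ?_
          rw [hz]
          simp only [Matrix.mul_assoc]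
      -- The added off-diagonal terms vanish by `hU0`, which is why that hypothesis allows an
      -- arbitrary `Y` in the middle.
      _ = ∑ i, ∑ j, U i * (U i)ᴴ * Y * (U j * (U j)ᴴ) := by
          refine Finset.sum_congr rfl fun i _ => ?_
          rw [Finset.sum_eq_single i]
          · intro j _ hij
            calc U i * (U i)ᴴ * Y * (U j * (U j)ᴴ)
                = U i * ((U i)ᴴ * Y * U j) * (U j)ᴴ := by simp only [Matrix.mul_assoc]
              _ = 0 := by rw [hU0 i j hij.symm, Matrix.mul_zero, Matrix.zero_mul]
          · simp
      _ = (∑ i, U i * (U i)ᴴ) * Y * (∑ j, U j * (U j)ᴴ) := by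
          rw [Matrix.sum_mul, Matrix.sum_mul]
          refine Finset.sum_congr rfl fun i _ => ?_
          rw [Matrix.mul_sum]
      _ = Y := by rw [hU1, Matrix.one_mul, Matrix.mul_one]

end Blocks

/-! ### The skew-adjoint matrices over the whole endomorphism algebra -/

namespace StarEnd

variable {A V E : Type*} [Ring A] [Algebra ℝ A] [AddCommGroup V] [Module ℝ V]
  [Module A V] [IsScalarTower ℝ A V] [Ring E] [StarRing E] [Algebra ℝ E] [StarModule ℝ E]
  [FiniteDimensional ℝ E] (S : StarEnd A V E)

/-- `cornerEmbedding` identifies `D`, with its own involution, with the full corner of `S.proj ρ`.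
-/
theorem exists_isSkewCorner (ρ : Submodule A V) [IsSimpleModule A ρ] {D : Type} [Ring D]
    [StarRing D] [Algebra ℝ D] [StarModule ℝ D]
    (hD : ∀ (y : D) (c : ℝ), 0 ≤ c → y * y = algebraMap ℝ D (-c) → star y = -y)
    (h : Nonempty (Module.End A ρ ≃ₐ[ℝ] D)) (N m : ℕ)
    (L : LieSubalgebra ℝ (Matrix (Fin (m * N)) (Fin (m * N)) D)) (hL : ∀ X, X ∈ L ↔ star X = -X) :
    ∃ Γ : L →ₗ⁅ℝ⁆ Matrix (Fin N × Fin m) (Fin N × Fin m) E, IsSkewCorner (S.proj ρ) Γ := by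
  obtain ⟨φ⟩ := h
  refine GNY.exists_isSkewCorner (S.cornerEmbedding hD φ)
    (fun x y h => φ.symm.injective (S.corner_injective _ _ h)) (S.star_proj ρ)
    (fun d => S.proj_mul_corner _) (fun x hx => ?_) L hL
    ((Equiv.prodComm _ _).trans finProdFinEquiv)
  obtain ⟨f, hf⟩ := S.exists_corner_eq ρ ρ x
  refine ⟨φ f, ?_⟩
  rw [← hx, ← hf]
  change S.corner ρ ρ (φ.symm (φ f)) = _
  rw [φ.symm_apply_apply]

include S in
/-- The skew-adjoint matrices over `E`, for a module decomposed into simple modules of real,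
complex and quaternionic type. -/
theorem exists_lieHom (N : ℕ) {nR nC nH : ℕ} (ρ : Fin nR ⊕ Fin nC ⊕ Fin nH → Submodule A V)
    (m : Fin nR ⊕ Fin nC ⊕ Fin nH → ℕ) [∀ j, IsSimpleModule A (ρ j)]
    (hne : ∀ i j, i ≠ j → IsEmpty (ρ i ≃ₗ[A] ρ j)) (φ : V ≃ₗ[A] ∀ a : Σ j, Fin (m j), ρ a.1)
    (hR : ∀ j, Nonempty (Module.End A (ρ (.inl j)) ≃ₐ[ℝ] ℝ))
    (hC : ∀ j, Nonempty (Module.End A (ρ (.inr (.inl j))) ≃ₐ[ℝ] ℂ))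
    (hH : ∀ j, Nonempty (Module.End A (ρ (.inr (.inr j))) ≃ₐ[ℝ] ℍ[ℝ])) :
    ∃ F : ((⨁ j, so (m (.inl j) * N)) × (⨁ j, GNY.u (m (.inr (.inl j)) * N)) ×
        (⨁ j, sp (m (.inr (.inr j)) * N))) →ₗ⁅ℝ⁆ Matrix (Fin N) (Fin N) E,
      Function.Injective F ∧ ∀ Y, Y ∈ Set.range F ↔ star Y = -Y := by
  classical
  choose ΓR hΓR using fun j => S.exists_isSkewCorner (ρ (.inl j))
    (fun _ _ => real_star_eq_neg) (hR j) N (m (.inl j)) (so _) fun X => by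
      rw [LieAlgebra.Orthogonal.mem_so]; rfl
  choose ΓC hΓC using fun j => S.exists_isSkewCorner (ρ (.inr (.inl j)))
    (fun _ _ => complex_star_eq_neg) (hC j) N (m (.inr (.inl j))) (GNY.u _) fun X => Iff.rfl
  choose ΓH hΓH using fun j => S.exists_isSkewCorner (ρ (.inr (.inr j)))
    (fun _ _ => quaternion_star_eq_neg) (hH j) N (m (.inr (.inr j))) (sp _) fun X => Iff.rfl
  obtain ⟨Γ', hΓ'⟩ := isJointSkewCorner_prod (ι := fun j => Fin N × Fin (m (.inr j)))
    (p := fun j => S.proj (ρ (.inr j)))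
    (isJointSkewCorner_directSum hΓC) (isJointSkewCorner_directSum hΓH)
  obtain ⟨Γ, hΓ⟩ := isJointSkewCorner_prod (ι := fun j => Fin N × Fin (m j))
    (p := fun j => S.proj (ρ j)) (isJointSkewCorner_directSum hΓR) hΓ'
  obtain ⟨u, hup, huu, hu0, hu1⟩ := S.exists_isometries (fun a : Σ j, Fin (m j) => ρ a.1) φ
  -- `U j` is `1_N ⊗ (u_{j,1}, …, u_{j,m_j})`, the row of isometries onto the copies of `ρ j`.
  let U (j) : Matrix (Fin N) (Fin N × Fin (m j)) E :=
    Matrix.of fun n a => if n = a.1 then u ⟨j, a.2⟩ else 0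
  have hUY (i j) (Y : Matrix (Fin N) (Fin N) E) (a b) :
      ((U i).conjTranspose * Y * U j) a b = star (u ⟨i, a.2⟩) * Y a.1 b.1 * u ⟨j, b.2⟩ := by
    simp [U, Matrix.mul_apply, apply_ite star]
  refine exists_lieHom_of_isometries (fun j => S.proj (ρ j)) Γ hΓ U (fun j => ?_) (fun j => ?_)
    (fun i j hij Y => ?_) ?_
  · ext a b
    have h := hUY j j 1 a b
    rw [Matrix.mul_one] at h
    rw [h, Matrix.diagonal_apply, Matrix.one_apply]
    by_cases hab : a = b
    · subst hab
      simp [huu]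
    · rw [if_neg hab]
      by_cases h1 : a.1 = b.1
      · have h2 : a.2 ≠ b.2 := fun h2 => hab (Prod.ext h1 h2)
        rw [if_pos h1, mul_one]
        exact hu0 _ _ fun h => h2 (by simpa using h)
      · simp [h1]
  · ext n a
    rw [Matrix.mul_diagonal]
    simp only [U, Matrix.of_apply]
    split_ifs
    · exact hup ⟨j, a.2⟩
    · simp
  · ext a b
    rw [hUY, ← hup ⟨i, a.2⟩, ← hup ⟨j, b.2⟩, star_mul, S.star_proj]
    have h := S.proj_mul_mul_proj_eq_zero (hne j i hij.symm)
      (star (u ⟨i, a.2⟩) * Y a.1 b.1 * u ⟨j, b.2⟩)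
    simpa only [mul_assoc, Matrix.zero_apply] using h
  · ext n n'
    rw [Matrix.sum_apply, Matrix.one_apply]
    have h (j) : (U j * (U j).conjTranspose) n n' =
        if n = n' then ∑ k, u ⟨j, k⟩ * star (u ⟨j, k⟩) else 0 := by
      simp only [U, Matrix.mul_apply, Matrix.conjTranspose_apply, Matrix.of_apply,
        Fintype.sum_prod_type, apply_ite star, star_zero, ite_mul, mul_ite, mul_zero, zero_mul]
      split_ifs with hn
      · subst hn
        rw [Finset.sum_eq_single n]
        · simp
        · intro b _ hb
          simp [hb.symm]
        · simp
      · refine Finset.sum_eq_zero fun a _ => Finset.sum_eq_zero fun k _ => ?_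
        split_ifs with h1 h2
        · exact absurd (h2.trans h1.symm) hn
        · rfl
        · rfl
    simp only [h]
    split_ifs
    · rw [← hu1, Fintype.sum_sigma]
    · simp

end StarEnd

end GNY

/-! ### Isotypic decomposition sorted by type -/

namespace GNY

/-- The properties may overlap: each index goes to the first one it satisfies. -/
theorem exists_equiv_sum_of_cover {ι : Type*} [Finite ι] (P Q R : ι → Prop)
    (h : ∀ i, P i ∨ Q i ∨ R i) : ∃ (a b c : ℕ) (e : Fin a ⊕ Fin b ⊕ Fin c ≃ ι),
      (∀ j, P (e (.inl j))) ∧ (∀ j, Q (e (.inr (.inl j)))) ∧ ∀ j, R (e (.inr (.inr j))) := by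
  classical
  let e₁ := Finite.equivFin {i // P i}
  let e₂ := Finite.equivFin {i : {i // ¬ P i} // Q i}
  let e₃ := Finite.equivFin {i : {i // ¬ P i} // ¬ Q i}
  refine ⟨_, _, _, (Equiv.sumCongr e₁.symm ((Equiv.sumCongr e₂.symm e₃.symm).trans
    (Equiv.sumCompl fun i : {i // ¬ P i} => Q i))).trans (Equiv.sumCompl P), fun j => ?_,
    fun j => ?_, fun j => ?_⟩
  · exact (e₁.symm j).2
  · exact (e₂.symm j).2
  · exact ((h _).resolve_left (e₃.symm j).1.2).resolve_left (e₃.symm j).2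

universe v

variable {A : Type*} {V : Type v} [Ring A] [AddCommGroup V] [Module A V]

/-- A finite semisimple module is a direct sum of multiples of pairwise non-isomorphic simple
submodules. -/
theorem exists_isotypic_decomposition [IsSemisimpleModule A V] [Module.Finite A V] :
    ∃ (ι : Type v) (_ : Finite ι) (S : ι → Submodule A V) (m : ι → ℕ), (∀ i, 0 < m i) ∧
      (∀ i, IsSimpleModule A (S i)) ∧ (∀ i j, i ≠ j → IsEmpty (S i ≃ₗ[A] S j)) ∧
      Nonempty (V ≃ₗ[A] ∀ i, Fin (m i) → S i) := by
  classical
  choose d pos S le simple e using fun c : isotypicComponents A V ↦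
    (IsIsotypic.isotypicComponents c.2).submodule_linearEquiv_fun
  have := Fintype.ofFinite (isotypicComponents A V)
  refine ⟨isotypicComponents A V, inferInstance, S, d, fun i => Nat.pos_of_ne_zero (pos i).out,
    simple, fun i j hij => ⟨fun f => hij (Subtype.ext ?_)⟩, ⟨?_⟩⟩
  · have := simple i
    have := simple j
    rw [eq_isotypicComponent_of_le i.2 (le i), eq_isotypicComponent_of_le j.2 (le j)]
    exact f.isotypicComponent_eq
  · exact (((sSupIndep_iff _).mp (sSupIndep_isotypicComponents A V)).linearEquiv
      ((sSup_eq_iSup' _).symm.trans (sSup_isotypicComponents A V))).symm.trans <|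
      (DirectSum.linearEquivFunOnFintype A _ fun c : isotypicComponents A V => c.1).trans <|
      LinearEquiv.piCongrRight fun c => (e c).some

/-- Flattening the three direct sums of multiples. -/
noncomputable def flattenEquiv {a b c : ℕ} (S : Fin a ⊕ Fin b ⊕ Fin c → Submodule A V)
    (m : Fin a ⊕ Fin b ⊕ Fin c → ℕ) :
    ((⨁ j, (Fin (m (.inl j)) → S (.inl j))) × (⨁ j, (Fin (m (.inr (.inl j))) → S (.inr (.inl j)))) ×
      (⨁ j, (Fin (m (.inr (.inr j))) → S (.inr (.inr j))))) ≃ₗ[A]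
    ∀ i : Σ j, Fin (m j), S i.1 :=
  (LinearEquiv.prodCongr (DirectSum.linearEquivFunOnFintype A _ _) <|
    (LinearEquiv.prodCongr (DirectSum.linearEquivFunOnFintype A _ _)
      (DirectSum.linearEquivFunOnFintype A _ _)).trans
    (LinearEquiv.sumPiEquivProdPi A _ _ fun j => Fin (m (.inr j)) → S (.inr j)).symm).trans <|
  (LinearEquiv.sumPiEquivProdPi A _ _ fun j => Fin (m j) → S j).symm.trans
    (LinearEquiv.piCurry A fun j (_ : Fin (m j)) => S j).symm

/-- The isotypic decomposition of a finite semisimple module, sorted by three properties covering all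
simple submodules. -/
theorem exists_sorted_decomposition [IsSemisimpleModule A V] [Module.Finite A V]
    (P Q R : Submodule A V → Prop) (h : ∀ ρ : Submodule A V, IsSimpleModule A ρ → P ρ ∨ Q ρ ∨ R ρ) :
    ∃ (a b c : ℕ) (S : Fin a ⊕ Fin b ⊕ Fin c → Submodule A V) (m : Fin a ⊕ Fin b ⊕ Fin c → ℕ),
      (∀ i, 0 < m i) ∧ (∀ i, IsSimpleModule A (S i)) ∧
      (∀ i j, i ≠ j → IsEmpty (S i ≃ₗ[A] S j)) ∧
      ((∀ j, P (S (.inl j))) ∧ (∀ j, Q (S (.inr (.inl j)))) ∧ ∀ j, R (S (.inr (.inr j)))) ∧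
      Nonempty (V ≃ₗ[A] (⨁ j, (Fin (m (.inl j)) → S (.inl j))) ×
        (⨁ j, (Fin (m (.inr (.inl j))) → S (.inr (.inl j)))) ×
        (⨁ j, (Fin (m (.inr (.inr j))) → S (.inr (.inr j))))) := by
  obtain ⟨ι, _, S, m, hm, simple, hne, ⟨φ⟩⟩ := exists_isotypic_decomposition (A := A) (V := V)
  obtain ⟨a, b, c, e, hP, hQ, hR⟩ := exists_equiv_sum_of_cover (fun i => P (S i))
    (fun i => Q (S i)) (fun i => R (S i)) fun i => h _ (simple i)
  refine ⟨a, b, c, fun j => S (e j), fun j => m (e j), fun _ => hm _, fun _ => simple _,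
    fun i j hij => hne _ _ (e.injective.ne hij), ⟨hP, hQ, hR⟩, ?_⟩
  let ψ : (∀ i, Fin (m i) → S i) ≃ₗ[A] ∀ j, Fin (m (e j)) → S (e j) :=
    (LinearEquiv.piCongrLeft A (fun i => Fin (m i) → S i) e).symm
  let χ : (∀ i : Σ j, Fin (m (e j)), S (e i.1)) ≃ₗ[A] ∀ j, Fin (m (e j)) → S (e j) :=
    LinearEquiv.piCurry A fun j (_ : Fin (m (e j))) => S (e j)
  exact ⟨φ.trans (ψ.trans (χ.symm.trans (flattenEquiv (fun j => S (e j)) fun j => m (e j)).symm))⟩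

end GNY

/-! ### The commutant of a star algebra of 4 × 4 matrices -/

namespace GNY

/-- The commutant of `A` in the real `4 × 4` matrices. -/
noncomputable abbrev comm (A : Subalgebra ℝ (Matrix (Fin 4) (Fin 4) ℝ)) :
    StarSubalgebra ℝ (Matrix (Fin 4) (Fin 4) ℝ) :=
  StarSubalgebra.centralizer ℝ (A : Set (Matrix (Fin 4) (Fin 4) ℝ))

variable {A : Subalgebra ℝ (Matrix (Fin 4) (Fin 4) ℝ)}

theorem subalgebra_smul (a : A) (v : V) : a • v = a.1.mulVec v := rfl

/-- The matrix of an `A`-linear endomorphism of `ℝ⁴`. -/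
noncomputable def endMatrix (f : Module.End A V) : Matrix (Fin 4) (Fin 4) ℝ :=
  LinearMap.toMatrix' (f.restrictScalars ℝ)

theorem endMatrix_mulVec (f : Module.End A V) (v : V) : (endMatrix f).mulVec v = f v := by
  simp [endMatrix, LinearMap.toMatrix'_mulVec]

theorem ext_mulVec {X Y : Matrix (Fin 4) (Fin 4) ℝ} (h : ∀ v : V, X.mulVec v = Y.mulVec v) :
    X = Y :=
  Matrix.toLin'.injective (LinearMap.ext h)

theorem mul_endMatrix (f : Module.End A V) (a : A) : a.1 * endMatrix f = endMatrix f * a.1 := by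
  refine ext_mulVec fun v => ?_
  rw [← Matrix.mulVec_mulVec, ← Matrix.mulVec_mulVec, endMatrix_mulVec, endMatrix_mulVec,
    ← subalgebra_smul, ← subalgebra_smul, map_smul]

variable (hA : ∀ a ∈ A, star a ∈ A)

/-- For a star algebra `A`, the `A`-linear endomorphisms of `ℝ⁴` form the commutant of `A`. -/
noncomputable def endEquiv : Module.End A V ≃ₐ[ℝ] comm A where
  toFun f := ⟨endMatrix f, (StarSubalgebra.mem_centralizer_iff ℝ).2 fun g hg =>
    ⟨mul_endMatrix f ⟨g, hg⟩, mul_endMatrix f ⟨star g, hA g hg⟩⟩⟩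
  invFun X :=
    { toFun := fun v => X.1.mulVec v
      map_add' := fun v w => Matrix.mulVec_add _ _ _
      map_smul' := fun a v => by
        rw [RingHom.id_apply, subalgebra_smul, subalgebra_smul, Matrix.mulVec_mulVec,
          Matrix.mulVec_mulVec, ((StarSubalgebra.mem_centralizer_iff ℝ).1 X.2 a.1 a.2).1] }
  left_inv f := LinearMap.ext fun v => endMatrix_mulVec f v
  right_inv X := Subtype.ext (ext_mulVec fun v => endMatrix_mulVec _ v)
  map_mul' f g := Subtype.ext (ext_mulVec fun v => by
    simp [endMatrix_mulVec, ← Matrix.mulVec_mulVec])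
  map_add' f g := Subtype.ext (ext_mulVec fun v => by
    simp [endMatrix_mulVec, Matrix.add_mulVec])
  commutes' c := Subtype.ext (ext_mulVec fun v => by
    simp [endMatrix_mulVec, Algebra.algebraMap_eq_smul_one, Matrix.smul_mulVec])

theorem endEquiv_mulVec (f : Module.End A V) (v : V) : (endEquiv hA f).1.mulVec v = f v :=
  endMatrix_mulVec f v

/-- The orthogonal complement of a submodule of `ℝ⁴` over a star algebra. -/
def orthCompl (ρ : Submodule A V) : Submodule A V where
  carrier := {v | ∀ w ∈ ρ, w ⬝ᵥ v = 0}
  zero_mem' := by simp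
  add_mem' := fun {x y} hx hy w hw => by rw [dotProduct_add, hx w hw, hy w hw, add_zero]
  smul_mem' := fun a v hv w hw => by
    have h := hv _ (ρ.smul_mem ⟨star a.1, hA _ a.2⟩ hw)
    rw [subalgebra_smul] at h ⊢
    rwa [Matrix.dotProduct_mulVec, ← Matrix.mulVec_transpose]

theorem isCompl_orthCompl (ρ : Submodule A V) : IsCompl ρ (orthCompl hA ρ) := by
  have hdis : Disjoint ρ (orthCompl hA ρ) := by
    rw [Submodule.disjoint_def]
    exact fun v hv hv' => dotProduct_self_eq_zero.1 (hv' v hv)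
  refine ⟨hdis, ?_⟩
  let B : LinearMap.BilinForm ℝ V := dotProductBilin ℝ ℝ
  have hB : B.IsRefl := fun v w h => by
    change w ⬝ᵥ v = 0
    rw [dotProduct_comm]
    exact h
  have h1 : IsCompl (ρ.restrictScalars ℝ) (B.orthogonal (ρ.restrictScalars ℝ)) := by
    rw [LinearMap.BilinForm.isCompl_orthogonal_iff_disjoint hB, Submodule.disjoint_def]
    exact fun v hv hv' => dotProduct_self_eq_zero.1 (hv' v hv)
  rw [Submodule.codisjoint_iff_exists_add_eq]
  intro v
  obtain ⟨x, y, hx, hy, h⟩ := Submodule.codisjoint_iff_exists_add_eq.1 h1.codisjoint v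
  exact ⟨x, y, hx, hy, h⟩

include hA in
theorem isSemisimpleModule : IsSemisimpleModule A V where
  __ := (inferInstance : Nontrivial (Submodule A V))
  exists_isCompl ρ := ⟨_, isCompl_orthCompl hA ρ⟩

/-- Orthogonal projection onto a submodule of `ℝ⁴` over a star algebra. -/
noncomputable def orthProj (ρ : Submodule A V) : V →ₗ[A] ρ :=
  ρ.projectionOnto _ (isCompl_orthCompl hA ρ)

@[simp]
theorem orthProj_apply_coe (ρ : Submodule A V) (v : ρ) : orthProj hA ρ v = v :=
  Submodule.projectionOnto_apply_left _ v

theorem orthProj_dotProduct (ρ : Submodule A V) (v w : V) :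
    (orthProj hA ρ v : V) ⬝ᵥ w = v ⬝ᵥ orthProj hA ρ w := by
  have key (v w : V) : (orthProj hA ρ v : V) ⬝ᵥ w = (orthProj hA ρ v : V) ⬝ᵥ orthProj hA ρ w := by
    have h : w - orthProj hA ρ w ∈ orthCompl hA ρ := by
      rw [← Submodule.ker_projectionOnto (isCompl_orthCompl hA ρ), LinearMap.mem_ker]
      change orthProj hA ρ _ = 0
      simp
    have := h _ (orthProj hA ρ v).2
    rwa [dotProduct_sub, sub_eq_zero] at this
  rw [key v w, dotProduct_comm v, key w v, dotProduct_comm]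

theorem star_endEquiv_orthProj (ρ : Submodule A V) :
    star (endEquiv hA (ρ.subtype ∘ₗ orthProj hA ρ)) =
      endEquiv hA (ρ.subtype ∘ₗ orthProj hA ρ) := by
  refine Subtype.ext (ext_mulVec fun v => dotProduct_eq _ _ fun w => ?_)
  change (endEquiv hA (ρ.subtype ∘ₗ orthProj hA ρ)).1.transpose.mulVec v ⬝ᵥ w = _
  rw [Matrix.mulVec_transpose, ← Matrix.dotProduct_mulVec, endEquiv_mulVec, endEquiv_mulVec]
  exact (orthProj_dotProduct hA ρ v w).symm

-- The square root is taken among all matrices; by functional calculus it commutes with whatever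
-- commutes with the sum, so it stays in the commutant.
open scoped MatrixOrder Matrix.Norms.L2Operator in
theorem exists_sqrt_comm {ι : Type} [Fintype ι] (x : ι → comm A) :
    ∃ q : comm A, star q = q ∧ q * q = ∑ i, star (x i) * x i := by
  set s : comm A := ∑ i, star (x i) * x i with hs
  have hs' : s.1 = ∑ i, star (x i).1 * (x i).1 := by
    rw [hs]
    exact map_sum (comm A).subtype _ _
  have hpos : 0 ≤ s.1 := by
    rw [hs']
    exact Finset.sum_nonneg fun i _ => star_mul_self_nonneg _
  have hcomm (g : Matrix (Fin 4) (Fin 4) ℝ) (h : g * s.1 = s.1 * g) :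
      g * CFC.sqrt s.1 = CFC.sqrt s.1 * g := by
    rw [CFC.sqrt_eq_cfc]
    exact (Commute.cfc_nnreal (show Commute s.1 g from h.symm) _).symm
  have hmem := (StarSubalgebra.mem_centralizer_iff ℝ).1 s.2
  refine ⟨⟨CFC.sqrt s.1, (StarSubalgebra.mem_centralizer_iff ℝ).2 fun g hg =>
    ⟨hcomm g (hmem g hg).1, hcomm _ (hmem g hg).2⟩⟩, Subtype.ext ?_, Subtype.ext ?_⟩
  · exact (CFC.sqrt_nonneg s.1).isSelfAdjoint
  · exact CFC.sqrt_mul_sqrt_self s.1 hpos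

open scoped MatrixOrder ComplexOrder in
/-- The commutant of a star algebra of `4 × 4` matrices as the endomorphism algebra of `ℝ⁴`. -/
noncomputable def starEnd : StarEnd A V (comm A) where
  equiv := endEquiv hA
  orthProj := orthProj hA
  orthProj_coe := orthProj_apply_coe hA
  star_orthProj := star_endEquiv_orthProj hA
  trace :=
    { toFun := fun x => x.1.trace
      map_add' := fun x y => Matrix.trace_add x.1 y.1
      map_smul' := fun c x => Matrix.trace_smul c x.1 }
  trace_pos x hx := by
    have h1 : 0 ≤ (x.1.conjTranspose * x.1).trace :=
      (Matrix.posSemidef_conjTranspose_mul_self x.1).trace_nonneg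
    have h2 : (x.1.conjTranspose * x.1).trace ≠ 0 := fun h =>
      hx (Subtype.ext (Matrix.trace_conjTranspose_mul_self_eq_zero_iff.1 h))
    exact lt_of_le_of_ne h1 h2.symm
  exists_sqrt _ _ x := exists_sqrt_comm x

end GNY

/-! ### Separation of types and transfer to the commutant Lie algebra -/

namespace GNY

theorem nonempty_lieEquiv_of_range_eq {L₁ L₂ L : Type*} [LieRing L₁] [LieAlgebra ℝ L₁] [LieRing L₂]
    [LieAlgebra ℝ L₂] [LieRing L] [LieAlgebra ℝ L] (f : L₁ →ₗ⁅ℝ⁆ L) (g : L₂ →ₗ⁅ℝ⁆ L)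
    (hf : Function.Injective f) (hg : Function.Injective g)
    (h : Set.range f = Set.range g) : Nonempty (L₁ ≃ₗ⁅ℝ⁆ L₂) := by
  have h' : (f.range : Set L) = g.range := by
    rw [LieHom.coe_range, LieHom.coe_range, h]
  exact ⟨((LieEquiv.ofInjective f hf).trans (LieEquiv.ofEq _ _ h')).trans
    (LieEquiv.ofInjective g hg).symm⟩

theorem isEmpty_algEquiv_of_finrank_ne {D D₁ D₂ : Type*} [Semiring D] [Algebra ℝ D] [Semiring D₁]
    [Algebra ℝ D₁] [Semiring D₂] [Algebra ℝ D₂]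
    (h : Module.finrank ℝ D₁ ≠ Module.finrank ℝ D₂) (h₁ : Nonempty (D ≃ₐ[ℝ] D₁)) :
    ¬ Nonempty (D ≃ₐ[ℝ] D₂) := fun ⟨e₂⟩ =>
  h₁.elim fun e₁ => h ((e₁.symm.trans e₂).toLinearEquiv.finrank_eq)

theorem finrank_real_ne_complex : Module.finrank ℝ ℝ ≠ Module.finrank ℝ ℂ := by
  rw [Module.finrank_self, Complex.finrank_real_complex]
  norm_num

theorem finrank_real_ne_quaternion : Module.finrank ℝ ℝ ≠ Module.finrank ℝ ℍ[ℝ] := by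
  rw [Module.finrank_self, Quaternion.finrank_eq_four]
  norm_num

theorem finrank_complex_ne_quaternion : Module.finrank ℝ ℂ ≠ Module.finrank ℝ ℍ[ℝ] := by
  rw [Complex.finrank_real_complex, Quaternion.finrank_eq_four]
  norm_num

/-- Conjugation by an isomorphism of modules would identify their endomorphism algebras, whose
dimensions differ. -/
theorem isEmpty_linearEquiv_of_end {A V D₁ D₂ : Type*} [Ring A] [Algebra ℝ A] [AddCommGroup V]
    [Module ℝ V] [Module A V] [IsScalarTower ℝ A V] [Ring D₁] [Algebra ℝ D₁] [Ring D₂]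
    [Algebra ℝ D₂] {ρ ρ' : Submodule A V}
    (h : Module.finrank ℝ D₁ ≠ Module.finrank ℝ D₂) (h₁ : Nonempty (Module.End A ρ ≃ₐ[ℝ] D₁))
    (h₂ : Nonempty (Module.End A ρ' ≃ₐ[ℝ] D₂)) : IsEmpty (ρ ≃ₗ[A] ρ') :=
  ⟨fun e => isEmpty_algEquiv_of_finrank_ne h (h₁.map fun φ => (e.conjAlgEquiv ℝ).symm.trans φ) h₂⟩

theorem finiteDimensional_comm (A : Subalgebra ℝ (Matrix (Fin 4) (Fin 4) ℝ)) :
    FiniteDimensional ℝ (comm A) :=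
  Module.Finite.of_injective (comm A).subtype.toAlgHom.toLinearMap Subtype.val_injective

section Clos

variable {M : ℕ} {R : Fin M → Matrix (Fin 4) (Fin 4) ℝ}

theorem star_mem_clos : ∀ a ∈ clos R, star a ∈ clos R := fun _ ha =>
  star_mem (s := StarAlgebra.adjoin ℝ (Set.range R)) ha

/-- The matrices commuting with both `X` and `star X` form a star algebra. Since `R m` is symmetric,
transposing `R m * X = X * R m` shows that it also commutes with `star X`, so this star algebra
contains `clos R`. -/
theorem mem_comm_clos (hR : ∀ m, (R m).IsSymm) (X : Matrix (Fin 4) (Fin 4) ℝ) :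
    X ∈ comm (clos R) ↔ ∀ m, R m * X = X * R m := by
  constructor
  · intro h m
    exact ((StarSubalgebra.mem_centralizer_iff ℝ).1 h (R m)
      (StarAlgebra.subset_adjoin ℝ _ ⟨m, rfl⟩)).1
  · intro h
    have hX : X ∈ StarSubalgebra.centralizer ℝ (Set.range R) := by
      rw [StarSubalgebra.mem_centralizer_iff]
      rintro _ ⟨m, rfl⟩
      have hs : star (R m) = R m := by
        rw [Matrix.star_eq_conjTranspose, Matrix.conjTranspose_eq_transpose_of_trivial, hR m]
      rw [hs]
      exact ⟨h m, h m⟩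
    have key : ∀ a ∈ clos R, a * X = X * a := by
      intro a ha
      have : StarAlgebra.adjoin ℝ (Set.range R) ≤ StarSubalgebra.centralizer ℝ {X} := by
        refine StarAlgebra.adjoin_le ?_
        rintro _ ⟨m, rfl⟩
        rw [SetLike.mem_coe, StarSubalgebra.mem_centralizer_iff]
        rintro _ rfl
        refine ⟨(h m).symm, ?_⟩
        have h' := congrArg star (h m)
        rw [star_mul, star_mul, Matrix.star_eq_conjTranspose (R m),
          Matrix.conjTranspose_eq_transpose_of_trivial, hR m] at h'
        exact h'
      exact (((StarSubalgebra.mem_centralizer_iff ℝ).1 (this ha) X rfl).1).symm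
    exact (StarSubalgebra.mem_centralizer_iff ℝ).2 fun g hg => ⟨key g hg, key _ (star_mem_clos g hg)⟩

/-- Matrices over the commutant as block matrices. -/
noncomputable def blockHom (A : Subalgebra ℝ (Matrix (Fin 4) (Fin 4) ℝ)) (N : ℕ) :
    Matrix (Fin N) (Fin N) (comm A) →ₐ[ℝ] Matrix (Fin N × Fin 4) (Fin N × Fin 4) ℝ :=
  (Matrix.compAlgEquiv (Fin N) (Fin 4) ℝ ℝ).toAlgHom.comp (comm A).subtype.toAlgHom.mapMatrix

theorem blockHom_injective (A : Subalgebra ℝ (Matrix (Fin 4) (Fin 4) ℝ)) (N : ℕ) :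
    Function.Injective (blockHom A N) := fun X Y h => by
  ext n n' i j
  exact congrFun (congrFun h (n, i)) (n', j)

theorem hat_mul_apply (N : ℕ) (T : Matrix (Fin 4) (Fin 4) ℝ)
    (X : Matrix (Fin N × Fin 4) (Fin N × Fin 4) ℝ) (n n' : Fin N) :
    (Matrix.of fun i j => (hat N T * X) (n, i) (n', j)) =
      T * Matrix.of fun i j => X (n, i) (n', j) := by
  ext i j
  simp [hat, Matrix.mul_apply, Fintype.sum_prod_type, Matrix.one_apply]

theorem mul_hat_apply (N : ℕ) (T : Matrix (Fin 4) (Fin 4) ℝ)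
    (X : Matrix (Fin N × Fin 4) (Fin N × Fin 4) ℝ) (n n' : Fin N) :
    (Matrix.of fun i j => (X * hat N T) (n, i) (n', j)) =
      (Matrix.of fun i j => X (n, i) (n', j)) * T := by
  ext i j
  simp [hat, Matrix.mul_apply, Fintype.sum_prod_type, Matrix.one_apply]

theorem lie_hat_eq_zero_iff (N : ℕ) (T : Matrix (Fin 4) (Fin 4) ℝ)
    (X : Matrix (Fin N × Fin 4) (Fin N × Fin 4) ℝ) :
    ⁅hat N T, X⁆ = 0 ↔ ∀ n n', T * (Matrix.of fun i j => X (n, i) (n', j)) =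
      (Matrix.of fun i j => X (n, i) (n', j)) * T := by
  rw [LieRing.of_associative_ring_bracket, sub_eq_zero]
  constructor
  · intro h n n'
    rw [← hat_mul_apply, ← mul_hat_apply, h]
  · intro h
    ext ⟨n, i⟩ ⟨n', j⟩
    have h' := h n n'
    rw [← hat_mul_apply, ← mul_hat_apply] at h'
    exact congrFun (congrFun h' i) j

/-- The commutant Lie algebra consists of the skew-adjoint matrices over the commutant of the
closure algebra. -/
theorem mem_range_blockHom_iff (hR : ∀ m, (R m).IsSymm) (N : ℕ)
    (X : Matrix (Fin N × Fin 4) (Fin N × Fin 4) ℝ) :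
    (∃ Y : Matrix (Fin N) (Fin N) (comm (clos R)), star Y = -Y ∧ blockHom (clos R) N Y = X) ↔
      X ∈ LieAlgebra.Orthogonal.so (Fin N × Fin 4) ℝ ∧ ∀ m, ⁅hat N (R m), X⁆ = 0 := by
  rw [LieAlgebra.Orthogonal.mem_so]
  simp only [lie_hat_eq_zero_iff]
  constructor
  · rintro ⟨Y, hY, rfl⟩
    refine ⟨Matrix.ext fun a b => ?_, fun m n n' => (mem_comm_clos hR _).1 (Y n n').2 m⟩
    have h := congrFun (congrFun hY a.1) b.1
    exact congrFun (congrFun (congrArg Subtype.val h) a.2) b.2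
  · rintro ⟨hX, hc⟩
    refine ⟨fun n n' => ⟨Matrix.of fun i j => X (n, i) (n', j),
      (mem_comm_clos hR _).2 fun m => hc m n n'⟩, ?_, rfl⟩
    ext n n' i j
    exact congrFun (congrFun hX (n, i)) (n', j)

/-- Both Lie algebras embed in the real matrices indexed by `Fin N × Fin 4` with the same image. -/
theorem nonempty_lieEquiv_commutant (hR : ∀ m, (R m).IsSymm) (N : ℕ) {L : Type*} [LieRing L]
    [LieAlgebra ℝ L] (F : L →ₗ⁅ℝ⁆ Matrix (Fin N) (Fin N) (comm (clos R)))
    (hF : Function.Injective F) (hrange : ∀ Y, Y ∈ Set.range F ↔ star Y = -Y) :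
    Nonempty (commutant N R ≃ₗ⁅ℝ⁆ L) := by
  refine nonempty_lieEquiv_of_range_eq
    ((LieAlgebra.Orthogonal.so (Fin N × Fin 4) ℝ).incl.comp (commutant N R).incl)
    ((blockHom (clos R) N).toLieHom.comp F)
    (fun X Y h => Subtype.ext (Subtype.ext h)) (fun x y h => hF (blockHom_injective _ _ h)) ?_
  ext X
  trans X ∈ LieAlgebra.Orthogonal.so (Fin N × Fin 4) ℝ ∧ ∀ m, ⁅hat N (R m), X⁆ = 0
  · constructor
    · rintro ⟨X, rfl⟩
      exact ⟨X.1.2, X.2⟩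
    · rintro ⟨h1, h2⟩
      exact ⟨⟨⟨X, h1⟩, h2⟩, rfl⟩
  · rw [← mem_range_blockHom_iff hR]
    constructor
    · rintro ⟨Y, hY, rfl⟩
      obtain ⟨z, rfl⟩ := (hrange Y).2 hY
      exact ⟨z, rfl⟩
    · rintro ⟨z, rfl⟩
      exact ⟨F z, (hrange _).1 ⟨z, rfl⟩, rfl⟩

theorem types_cover (ρ : Submodule (clos R) V) (hρ : IsSimpleModule (clos R) ρ) :
    IsRealType ρ ∨ IsComplexType ρ ∨ IsQuaternionicType ρ :=
  haveI := finiteDimensional_comm (clos R)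
  (starEnd (star_mem_clos (R := R))).nonempty_algEquiv ρ

theorem nonempty_irrepDecomposition : Nonempty (IrrepDecomposition (clos R)) := by
  have := isSemisimpleModule (star_mem_clos (R := R))
  have : Module.Finite (clos R) V := Module.Finite.of_restrictScalars_finite ℝ _ _
  obtain ⟨a, b, c, S, m, hm, hs, hne, ⟨hP, hQ, hR⟩, φ⟩ := exists_sorted_decomposition
    (A := clos R) (V := V) IsRealType IsComplexType IsQuaternionicType types_cover
  exact ⟨
    { numR := a, numC := b, numH := c
      ρR := fun j => S (.inl j)
      ρC := fun j => S (.inr (.inl j))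
      ρH := fun j => S (.inr (.inr j))
      mR := fun j => m (.inl j)
      mC := fun j => m (.inr (.inl j))
      mH := fun j => m (.inr (.inr j))
      mR_pos := fun _ => hm _
      mC_pos := fun _ => hm _
      mH_pos := fun _ => hm _
      simpleR := fun _ => hs _
      simpleC := fun _ => hs _
      simpleH := fun _ => hs _
      typeR := hP
      typeC := hQ
      typeH := hR
      distinctR := fun i j hij => hne _ _ (by simpa using hij)
      distinctC := fun i j hij => hne _ _ (by simpa using hij)
      distinctH := fun i j hij => hne _ _ (by simpa using hij)
      iso := φ }⟩

theorem nonempty_commutant_equiv (hR : ∀ m, (R m).IsSymm) (N : ℕ)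
    (d : IrrepDecomposition (clos R)) :
    Nonempty (commutant N R ≃ₗ⁅ℝ⁆
      (⨁ j, so (d.mR j * N)) × (⨁ j, u (d.mC j * N)) × (⨁ j, sp (d.mH j * N))) := by
  obtain ⟨φ⟩ := d.iso
  let ρ : Fin d.numR ⊕ Fin d.numC ⊕ Fin d.numH → Submodule (clos R) V :=
    Sum.elim d.ρR (Sum.elim d.ρC d.ρH)
  let m : Fin d.numR ⊕ Fin d.numC ⊕ Fin d.numH → ℕ := Sum.elim d.mR (Sum.elim d.mC d.mH)
  have hs : ∀ j, IsSimpleModule (clos R) (ρ j) := by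
    rintro (j | j | j)
    · exact d.simpleR j
    · exact d.simpleC j
    · exact d.simpleH j
  -- `IrrepDecomposition` demands non-isomorphism only within a type; across types the dimensions 1,
  -- 2, 4 of the endomorphism algebras provide it.
  have hne : ∀ i j, i ≠ j → IsEmpty (ρ i ≃ₗ[clos R] ρ j) := by
    rintro (i | i | i) (j | j | j) hij
    · exact d.distinctR i j (by simpa using hij)
    · exact isEmpty_linearEquiv_of_end finrank_real_ne_complex (d.typeR i) (d.typeC j)
    · exact isEmpty_linearEquiv_of_end finrank_real_ne_quaternion (d.typeR i) (d.typeH j)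
    · exact isEmpty_linearEquiv_of_end finrank_real_ne_complex.symm (d.typeC i) (d.typeR j)
    · exact d.distinctC i j (by simpa using hij)
    · exact isEmpty_linearEquiv_of_end finrank_complex_ne_quaternion (d.typeC i) (d.typeH j)
    · exact isEmpty_linearEquiv_of_end finrank_real_ne_quaternion.symm (d.typeH i) (d.typeR j)
    · exact isEmpty_linearEquiv_of_end finrank_complex_ne_quaternion.symm (d.typeH i) (d.typeC j)
    · exact d.distinctH i j (by simpa using hij)
  have := finiteDimensional_comm (clos R)
  obtain ⟨F, hF, hrange⟩ := (starEnd (star_mem_clos (R := R))).exists_lieHom N ρ m hne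
    (φ.trans (flattenEquiv ρ m)) d.typeR d.typeC d.typeH
  exact nonempty_lieEquiv_commutant hR N F hF hrange

end Clos

end GNY

theorem mainTheorem4 (M N_D : ℕ) (R : Fin M → Matrix (Fin 4) (Fin 4) ℝ)
    (hR : ∀ m, (R m).IsSymm) :
    Nonempty (GNY.IrrepDecomposition (GNY.clos R)) ∧
    (∀ ρ : Submodule (GNY.clos R) GNY.V, IsSimpleModule (GNY.clos R) ρ →
      (GNY.IsRealType ρ ∧ ¬ GNY.IsComplexType ρ ∧ ¬ GNY.IsQuaternionicType ρ) ∨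
      (¬ GNY.IsRealType ρ ∧ GNY.IsComplexType ρ ∧ ¬ GNY.IsQuaternionicType ρ) ∨
      (¬ GNY.IsRealType ρ ∧ ¬ GNY.IsComplexType ρ ∧ GNY.IsQuaternionicType ρ)) ∧
    ∀ d : GNY.IrrepDecomposition (GNY.clos R),
      Nonempty (GNY.commutant N_D R ≃ₗ⁅ℝ⁆
        (⨁ j, GNY.so (d.mR j * N_D)) × (⨁ j, GNY.u (d.mC j * N_D)) ×
          (⨁ j, GNY.sp (d.mH j * N_D))) := by
  refine ⟨GNY.nonempty_irrepDecomposition, fun ρ hρ => ?_,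
    GNY.nonempty_commutant_equiv hR N_D⟩
  rcases GNY.types_cover ρ hρ with h | h | h
  · exact .inl ⟨h, GNY.isEmpty_algEquiv_of_finrank_ne GNY.finrank_real_ne_complex h,
      GNY.isEmpty_algEquiv_of_finrank_ne GNY.finrank_real_ne_quaternion h⟩
  · exact .inr (.inl ⟨GNY.isEmpty_algEquiv_of_finrank_ne GNY.finrank_real_ne_complex.symm h, h,
      GNY.isEmpty_algEquiv_of_finrank_ne GNY.finrank_complex_ne_quaternion h⟩)
  · exact .inr (.inr ⟨GNY.isEmpty_algEquiv_of_finrank_ne GNY.finrank_real_ne_quaternion.symm h,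
      GNY.isEmpty_algEquiv_of_finrank_ne GNY.finrank_complex_ne_quaternion.symm h, h⟩)
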